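/- Let $x_1,\dots,x_n\in\mathbb R^p$ with $\|x_i\|_2=1$ and $y_1,\dots,y_n\in\mathbb R$ with $|y_i|<C$. Consider the two-layer ReLU network $f(W,a,x)=\frac1{\sqrt m}\sum_{r=1}^m a_r\,\sigma(w_r^\top x)$, $\sigma(z)=\max\{z,0\}$, $W=(w_1,\dots,w_m)$, the error $\Delta_i=f(W,a,x_i)-y_i$, the loss $L(W,a)=\frac12\sum_{i=1}^n\Delta_i^2$ with gradient $\frac{\partial L}{\partial w_r}=\sum_i\Delta_i\frac{\partial f_i}{\partial w_r}$, $\frac{\partial f_i}{\partial w_r}=\frac1{\sqrt m}a_r\mathbb I\{w_r^\top x_i\ge0\}x_i$, the neural tangent kernel $H_{ij}=\sum_{r}\big\langle\frac{\partial f_i}{\partial w_r},\frac{\partial f_j}{\partial w_r}\big\rangle$, and the pseudo-loss $\hat L=\frac12\Delta^\top H\Delta$. Let $H^\infty_{ij}=\mathbb E_{w\sim\mathcal N(0,I)}\big[x_i^\top x_j\,\mathbb I\{w^\top x_i\ge0,\,w^\top x_j\ge0\}\big]$ and let $\lambda_0$ be the smallest eigenvalue of $H^\infty$. Only $W$ is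 trained; $a$ stays at its initial value. NAG-SC with step size $\eta$ is the iteration with constant momentum $$v_r(k+1)=w_r(k)-\eta\frac{\partial L}{\partial w_r(k)},\qquad w_r(k+1)=v_r(k+1)+\frac{1-\sqrt{\lambda_0\eta/2}}{1+\sqrt{\lambda_0\eta/2}}\,\big(v_r(k+1)-v_r(k)\big).$$ (1) The limiting ODE of NAG-SC is the Heavy Ball ODE with $b=\sqrt{2\lambda_0}$: $$\ddot w_r(t)+\sqrt{2\lambda_0}\,\dot w_r(t)+\frac{\partial L(W(t),a)}{\partial w_r(t)}=0 .$$ That is, if a curve $X$ of weights is differentiable near $t$ and twice differentiable at $t$, with $X_r(t)^\top x_i\ne0$ for all $r,i$, and $N_\eta$ denotes the NAG-SC update $w(k+1)$ computed from $w(k-1)=X(t-\sqrt\eta)$ and $w(k)=X(t)$, then $$\lim_{\eta\to0^+}\frac{X(t+\sqrt\eta)-N_\eta}{\eta}=\ddot X(t)+\sqrt{2\lambda_0}\,\dot X(t)+\frac{\partial L(X(t),a)}{\partial W}.$$ (2) For every $C$ there is a constant $K>0$ depending only on $C$ such that, for all data as above with $\lambda_0>0$, all $\delta\in(0,1)$ and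 all widths $m\ge K\,\frac{n^6}{\delta^3\lambda_0^4}$, the following holds. If $w_r(0)\sim\mathcal N(0,I)$ and $a_r\sim\mathrm{unif}\{-1,1\}$, $r\in[m]$, are all independent, then with probability at least $1-\delta$ over the initialization every trajectory $W(t)$, $t\ge0$, of the limiting ODE in (1) with initial weights $W(0)$ and $\dot W(0)=0$ satisfies $$L(t)\le\frac4{\lambda_0}\exp\!\big(-\sqrt{\lambda_0/2}\;t\big)\,\hat L(0)\qquad\text{for all }t\ge0 .$$ Here $L(t)$ and $\hat L(0)$ are the loss at time $t$ and the pseudo-loss at time $0$ along the trajectory. Since $\partial L/\partial W$ jumps where some $w_r^\top x_i=0$, trajectories are understood as solutions of the differential inclusion: $W$ is $C^1$, $\dot W$ is locally absolutely continuous, and the equation holds for almost every $t$, where at a kink $w_r^\top x_i=0$ the indicator in $\partial L/\partial w_r$ may be replaced by any number in $[0,1]$. -/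

import Mathlib

open MeasureTheory ProbabilityTheory Filter Topology Set

noncomputable section

namespace NAGSC

/-- First-layer weights `W = (w_1, …, w_m)` with `w_r ∈ ℝ^p` (Euclidean norm on each `w_r`). -/
abbrev Weights (m p : ℕ) : Type := Fin m → EuclideanSpace ℝ (Fin p)

/-- ReLU activation. -/
def relu (z : ℝ) : ℝ := max z 0

/-- The derivative of ReLU, with the convention `σ'(0) = 1`, i.e. the indicator of `z ≥ 0`. -/
def reluDeriv (z : ℝ) : ℝ := if 0 ≤ z then 1 else 0

/-- The (Clarke) subdifferential of ReLU: `{1}` for `z > 0`, `{0}` for `z < 0`, `[0,1]` at `0`. -/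
def reluSubdiff (z : ℝ) : Set ℝ :=
  {s | 0 ≤ s ∧ s ≤ 1 ∧ (0 < z → s = 1) ∧ (z < 0 → s = 0)}

variable {m p n : ℕ}

/-- The network `f(W, a, x) = m^{-1/2} ∑_r a_r σ(w_r ⬝ x)`. -/
def net (a : Fin m → ℝ) (W : Weights m p) (x : EuclideanSpace ℝ (Fin p)) : ℝ :=
  (1 / √(m : ℝ)) * ∑ r, a r * relu (inner ℝ (W r) x)

/-- The error `Δ = f - y`. -/
def err (x : Fin n → EuclideanSpace ℝ (Fin p)) (y : Fin n → ℝ) (a : Fin m → ℝ)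
    (W : Weights m p) (i : Fin n) : ℝ :=
  net a W (x i) - y i

/-- The MSE loss `L = (1/2) ∑_i (f(W, a, x_i) - y_i)^2`. -/
def loss (x : Fin n → EuclideanSpace ℝ (Fin p)) (y : Fin n → ℝ) (a : Fin m → ℝ)
    (W : Weights m p) : ℝ :=
  (1 / 2) * ∑ i, err x y a W i ^ 2

/-- `∂f_i/∂w_r = m^{-1/2} a_r 1{w_r ⬝ x_i ≥ 0} x_i`. -/
def netGrad (x : Fin n → EuclideanSpace ℝ (Fin p)) (a : Fin m → ℝ)
    (W : Weights m p) (i : Fin n) (r : Fin m) : EuclideanSpace ℝ (Fin p) :=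
  (1 / √(m : ℝ) * a r * reluDeriv (inner ℝ (W r) (x i))) • x i

/-- The gradient `∂L/∂w_r = ∑_i (f_i - y_i) ∂f_i/∂w_r` of the loss. -/
def lossGrad (x : Fin n → EuclideanSpace ℝ (Fin p)) (y : Fin n → ℝ) (a : Fin m → ℝ)
    (W : Weights m p) : Weights m p :=
  fun r => ∑ i, err x y a W i • netGrad x a W i r

/-- The set of generalized gradients of the loss: the value of `σ'` at a kink `w_r ⬝ x_i = 0` may be
any number in `[0,1]`. Away from the kinks this is the singleton `{lossGrad x y a W}`. -/
def lossGenGrad (x : Fin n → EuclideanSpace ℝ (Fin p)) (y : Fin n → ℝ) (a : Fin m → ℝ)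
    (W : Weights m p) : Set (Weights m p) :=
  {G | ∃ s : Fin m → Fin n → ℝ, (∀ r i, s r i ∈ reluSubdiff (inner ℝ (W r) (x i))) ∧
    ∀ r, G r = ∑ i, err x y a W i • ((1 / √(m : ℝ) * a r * s r i) • x i)}

/-- The NTK matrix `H_{ij} = ∑_r ⟨∂f_i/∂w_r, ∂f_j/∂w_r⟩`. -/
def ntk (x : Fin n → EuclideanSpace ℝ (Fin p)) (a : Fin m → ℝ) (W : Weights m p) :
    Matrix (Fin n) (Fin n) ℝ :=
  Matrix.of fun i j => ∑ r, inner ℝ (netGrad x a W i r) (netGrad x a W j r)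

/-- The pseudo-loss `L̂ = (1/2) Δᵀ H Δ`. -/
def pseudoLoss (x : Fin n → EuclideanSpace ℝ (Fin p)) (y : Fin n → ℝ) (a : Fin m → ℝ)
    (W : Weights m p) : ℝ :=
  (1 / 2) * (err x y a W ⬝ᵥ (ntk x a W).mulVec (err x y a W))

/-- The limiting kernel
`H^∞_{ij} = E_{w ∼ N(0, I)} [x_i ⬝ x_j 1{w ⬝ x_i ≥ 0, w ⬝ x_j ≥ 0}]`. -/
def limitNTK (x : Fin n → EuclideanSpace ℝ (Fin p)) : Matrix (Fin n) (Fin n) ℝ :=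
  Matrix.of fun i j => ∫ w : EuclideanSpace ℝ (Fin p),
    inner ℝ (x i) (x j) * (reluDeriv (inner ℝ w (x i)) * reluDeriv (inner ℝ w (x j)))
      ∂(stdGaussian (EuclideanSpace ℝ (Fin p)))

/-- `λ₀`, the smallest eigenvalue of `H^∞`. -/
def lam0 (x : Fin n → EuclideanSpace ℝ (Fin p)) : ℝ :=
  sInf (spectrum ℝ (limitNTK x))

/-- Law of the initialization: `w_r ∼ N(0, I)` and `a_r ∼ unif{-1, 1}`, all independent. -/
def initLaw (m p : ℕ) : Measure (Weights m p × (Fin m → ℝ)) :=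
  (Measure.pi fun _ : Fin m => stdGaussian (EuclideanSpace ℝ (Fin p))).prod
    (Measure.pi fun _ : Fin m =>
      (2⁻¹ : ENNReal) • Measure.dirac (1 : ℝ) + (2⁻¹ : ENNReal) • Measure.dirac (-1 : ℝ))

/-- The constant momentum `(1 - √(λη/2)) / (1 + √(λη/2))` of NAG-SC. -/
def nagMomentum (lam η : ℝ) : ℝ := (1 - √(lam * η / 2)) / (1 + √(lam * η / 2))

/-- The half step of NAG-SC: `v(k+1) = w(k) - η ∂L/∂w(k)`. -/
def nagHalf (x : Fin n → EuclideanSpace ℝ (Fin p)) (y : Fin n → ℝ) (a : Fin m → ℝ)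
    (η : ℝ) (W : Weights m p) : Weights m p :=
  W - η • lossGrad x y a W

/-- The NAG-SC update `w(k+1) = v(k+1) + momentum • (v(k+1) - v(k))` as a function of
`w(k-1)` and `w(k)`. -/
def nagStep (x : Fin n → EuclideanSpace ℝ (Fin p)) (y : Fin n → ℝ) (a : Fin m → ℝ)
    (η : ℝ) (Wprev W : Weights m p) : Weights m p :=
  nagHalf x y a η W +
    nagMomentum (lam0 x) η • (nagHalf x y a η W - nagHalf x y a η Wprev)

/-- `W`, restricted to `[0, ∞)`, is a trajectory of the Heavy Ball with Friction system
`ẅ_r + b ẇ_r + ∂L/∂w_r = 0` with `W(0) = W₀`, `Ẇ(0) = 0`.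

As `∂L/∂w_r` is discontinuous at the kinks of ReLU, the equation is understood in the sense of
differential inclusions: `W` is `C¹` with velocity `V`, and `V` is locally absolutely continuous
with `V' + b V + G = 0` a.e. (written in integrated form), where `G(t)` is, for almost
every `t`, a generalized gradient of the loss at `W(t)`. -/
def IsHBFlow (x : Fin n → EuclideanSpace ℝ (Fin p)) (y : Fin n → ℝ) (a : Fin m → ℝ)
    (b : ℝ) (W₀ : Weights m p) (W : ℝ → Weights m p) : Prop :=
  W 0 = W₀ ∧
  ∃ V G : ℝ → Weights m p,
    ContinuousOn V (Ici 0) ∧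
    (∀ t, 0 ≤ t → HasDerivWithinAt W (V t) (Ici 0) t) ∧
    (∀ t, 0 ≤ t → IntervalIntegrable G volume 0 t) ∧
    (∀ᵐ t : ℝ, 0 ≤ t → G t ∈ lossGenGrad x y a (W t)) ∧
    ∀ t, 0 ≤ t → V t = -∫ s in (0 : ℝ)..t, (b • V s + G s)

end NAGSC

end

noncomputable section

namespace NAGSC

/-! For the limiting ODE, put h = √η and let β be the momentum. The defect of the scheme divided by
h² is the second difference quotient of X, plus ((1-β)/h) times the backward difference quotient,
plus the gradient at X(t), plus β times the difference of the gradients at X(t) and X(t-h). Here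
(1-β)/h tends to √(2λ₀), and the last term vanishes because the gradient is continuous off the
kinks.

For the decay of the loss, let s₀ be the activation pattern at time 0, H the NTK at time 0, and P_i
= m^{-1/2} ∑_r a_r s₀_{ri} ẇ_r·x_i. If the pattern never changed, then Δ' = P and P' = -bP - HΔ.
With b² = 2λ₀ and q = P + (b/2)Δ this becomes q' = -(b/2)q - AΔ, Δ' = q - (b/2)Δ, where A = H -
(λ₀/2)I, and the energy E = q·A⁻¹q + |Δ|² satisfies E' = -bE exactly (`hasDerivAt_energy`). Changes
of pattern add forcing terms, which `energy_young` absorbs at the price of the rate 3b/4 in place of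
b.

The forcing is controlled by continuous induction (`lt_of_bootstrap`,
`IsScalarFlow.bootstrap_step`). While |Δ(t)|² ≤ B² exp(-bt/2), every pre-activation moves by at most
R of order √n B/(λ₀√m), so a neuron can flip at x_i only if its initial pre-activation there is at
most R in absolute value. If such pairs are few, the energy balance returns the same bound with the
factor 2/3, and the induction closes.

Randomness matters only at time 0. Three Markov inequalities (`exists_good_initialization`) give H
within λ₀/8 of H^∞ in Frobenius norm, |Δ(0)|² of order n/δ, and few pairs near a kink. The kinks
themselves are harmless for the differential inclusion: where relu ∘ u is differentiable, its
derivative does not depend on the chosen subgradient (`hasDerivAt_relu_comp`). -/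

/-! ### Consistency of NAG-SC with the heavy ball equation -/

/-- The symmetric second difference quotient converges to the second derivative. -/
theorem tendsto_second_difference {E : Type*} [NormedAddCommGroup E] [NormedSpace ℝ E]
    {X X' : ℝ → E} {X'' : E} {t : ℝ} (hX : ∀ᶠ s in 𝓝 t, HasDerivAt X (X' s) s)
    (hX' : HasDerivAt X' X'' t) :
    Tendsto (fun h : ℝ => (h ^ 2)⁻¹ • (X (t + h) - X t - (X t - X (t - h)))) (𝓝[≠] 0)
      (𝓝 X'') := by
  obtain ⟨ε, hε, hball⟩ := Metric.eventually_nhds_iff_ball.1 hX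
  -- Subtracting the Taylor terms leaves a function whose derivative is o(s - t), so its increment
  -- from t is o((s - t)²). Only differentiability of `X'` at the single point `t` is used.
  set f : ℝ → E := fun s => X s - (s - t) • X' t - ((s - t) ^ 2 / 2) • X''
  have hfd : ∀ s ∈ Metric.ball t ε,
      HasDerivWithinAt f (X' s - X' t - (s - t) • X'') (Metric.ball t ε) s := by
    intro s hs
    have h1 : HasDerivAt (fun s : ℝ => (s - t)) 1 s := (hasDerivAt_id s).sub_const t
    have h2 : HasDerivAt (fun s : ℝ => (s - t) ^ 2 / 2) (s - t) s := by
      have := (h1.pow 2).div_const 2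
      convert! this using 1
      simp
    have h3 := (((hball s hs).sub (h1.smul_const (X' t))).sub
      (h2.smul_const X'')).hasDerivWithinAt (s := Metric.ball t ε)
    rw [one_smul] at h3
    exact h3
  have ho := (convex_ball t ε).isLittleO_pow_succ_real (n := 1) (Metric.mem_ball_self hε) hfd (by
    have := hasDerivAt_iff_isLittleO.1 hX'
    simpa using this.mono nhdsWithin_le_nhds)
  rw [nhdsWithin_eq_nhds.2 (Metric.ball_mem_nhds t hε)] at ho
  have hp : Tendsto (fun h : ℝ => t + h) (𝓝 0) (𝓝 t) := by
    have : Continuous (fun h : ℝ => t + h) := by fun_prop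
    simpa using this.tendsto 0
  have hm : Tendsto (fun h : ℝ => t - h) (𝓝 0) (𝓝 t) := by
    have : Continuous (fun h : ℝ => t - h) := by fun_prop
    simpa using this.tendsto 0
  have h1 := ho.comp_tendsto hp
  have h2 := ho.comp_tendsto hm
  have h3 : (fun h : ℝ => (f (t + h) - f t) + (f (t - h) - f t)) =o[𝓝 0] fun h : ℝ => h ^ 2 := by
    refine Asymptotics.IsLittleO.add ?_ ?_
    · simpa [Function.comp_def] using h1
    · simpa [Function.comp_def] using h2
  have h4 := ((h3.mono nhdsWithin_le_nhds).tendsto_inv_smul_nhds_zero (l := 𝓝[≠] 0)).add_const X''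
  rw [zero_add] at h4
  refine h4.congr' ?_
  filter_upwards [self_mem_nhdsWithin] with h hh
  have hh : h ≠ 0 := hh
  have e : (f (t + h) - f t) + (f (t - h) - f t)
      = (X (t + h) - X t - (X t - X (t - h))) - (h ^ 2) • X'' := by
    simp only [f]
    have a1 : t + h - t = h := by ring
    have a2 : t - h - t = -h := by ring
    rw [a1, a2]
    simp only [sub_self, zero_smul]
    module
  rw [e, smul_sub, smul_smul, inv_mul_cancel₀ (by positivity), one_smul, sub_add_cancel]

theorem continuousAt_reluDeriv {z : ℝ} (hz : z ≠ 0) : ContinuousAt reluDeriv z := by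
  rcases lt_or_gt_of_ne hz with h | h
  · have : reluDeriv =ᶠ[𝓝 z] fun _ => 0 := by
      filter_upwards [Iio_mem_nhds h] with s hs
      simpa [reluDeriv] using hs
    exact continuousAt_const.congr this.symm
  · have : reluDeriv =ᶠ[𝓝 z] fun _ => 1 := by
      filter_upwards [Ioi_mem_nhds h] with s hs
      simpa [reluDeriv] using le_of_lt (mem_Ioi.1 hs)
    exact continuousAt_const.congr this.symm

theorem continuous_relu : Continuous relu := by unfold relu; fun_prop

variable {m p n : ℕ}

theorem continuous_err (x : Fin n → EuclideanSpace ℝ (Fin p)) (y : Fin n → ℝ) (a : Fin m → ℝ)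
    (i : Fin n) : Continuous fun W : Weights m p => err x y a W i := by
  have := continuous_relu
  unfold err net
  fun_prop

/-- Away from the kinks the gradient of the loss is continuous. -/
theorem continuousAt_lossGrad (x : Fin n → EuclideanSpace ℝ (Fin p)) (y : Fin n → ℝ)
    (a : Fin m → ℝ) (W : Weights m p) (hW : ∀ r i, inner ℝ (W r) (x i) ≠ 0) :
    ContinuousAt (lossGrad x y a) W := by
  refine continuousAt_pi.2 fun r => ?_
  unfold lossGrad netGrad
  refine tendsto_finsetSum _ fun i _ => ?_
  refine Tendsto.smul ((continuous_err x y a i).tendsto W) ?_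
  change ContinuousAt (fun W : Weights m p =>
    (1 / √(m : ℝ) * a r * reluDeriv (inner ℝ (W r) (x i))) • x i) W
  have h1 : ContinuousAt (fun W : Weights m p => inner ℝ (W r) (x i)) W :=
    ((continuous_apply r).inner continuous_const).continuousAt
  have h2 := ContinuousAt.comp (f := fun W : Weights m p => inner ℝ (W r) (x i))
    (continuousAt_reluDeriv (hW r i)) h1
  exact (continuousAt_const.mul h2).smul continuousAt_const

theorem tendsto_momentum (lam : ℝ) :
    Tendsto (fun h : ℝ => h⁻¹ * (1 - nagMomentum lam (h ^ 2))) (𝓝[>] 0) (𝓝 √(2 * lam)) := by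
  -- A nonnegative square can be pulled out of the root whatever the sign of `lam`; for negative
  -- `lam` all these roots are 0 and the limit is 0.
  have hs : √(2 * lam) = 2 * √(lam / 2) := by
    rw [show 2 * lam = 2 ^ 2 * (lam / 2) by ring, Real.sqrt_mul (by norm_num),
      Real.sqrt_sq (by norm_num)]
  have h1 : Tendsto (fun h : ℝ => 2 * √(lam / 2) / (1 + h * √(lam / 2))) (𝓝[>] 0)
      (𝓝 √(2 * lam)) := by
    have : ContinuousAt (fun h : ℝ => 2 * √(lam / 2) / (1 + h * √(lam / 2))) 0 := by
      refine ContinuousAt.div ?_ ?_ (by simp) <;> fun_prop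
    have h := this.tendsto
    rw [zero_mul, add_zero, div_one] at h
    rw [hs]
    exact h.mono_left nhdsWithin_le_nhds
  refine h1.congr' ?_
  filter_upwards [self_mem_nhdsWithin] with h hh
  have hh : 0 < h := hh
  have e : √(lam * h ^ 2 / 2) = h * √(lam / 2) := by
    rw [show lam * h ^ 2 / 2 = h ^ 2 * (lam / 2) by ring, Real.sqrt_mul (by positivity),
      Real.sqrt_sq hh.le]
  have : 0 < 1 + h * √(lam / 2) := by positivity
  rw [nagMomentum, e]
  field_simp
  ring

/-- The update of NAG-SC is consistent with the heavy ball equation with `b = √(2λ₀)`. -/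
theorem tendsto_nagStep (x : Fin n → EuclideanSpace ℝ (Fin p)) (y : Fin n → ℝ) (a : Fin m → ℝ)
    (X X' : ℝ → Weights m p) (X'' : Weights m p) (t : ℝ)
    (hX : ∀ᶠ s in 𝓝 t, HasDerivAt X (X' s) s) (hX' : HasDerivAt X' X'' t)
    (hne : ∀ r i, inner ℝ (X t r) (x i) ≠ 0) :
    Tendsto (fun η : ℝ => η⁻¹ • (X (t + √η) - nagStep x y a η (X (t - √η)) (X t)))
      (𝓝[>] 0) (𝓝 (X'' + √(2 * lam0 x) • X' t + lossGrad x y a (X t))) := by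
  have hsq : Tendsto (fun η : ℝ => √η) (𝓝[>] 0) (𝓝[>] 0) := by
    refine tendsto_nhdsWithin_iff.2 ⟨?_, ?_⟩
    · have := Real.continuous_sqrt.tendsto 0
      rw [Real.sqrt_zero] at this
      exact this.mono_left nhdsWithin_le_nhds
    · filter_upwards [self_mem_nhdsWithin] with η hη
      exact Real.sqrt_pos.2 hη
  have hm : Tendsto (fun h : ℝ => t - h) (𝓝[>] 0) (𝓝 t) := by
    have : Continuous (fun h : ℝ => t - h) := by fun_prop
    have := this.tendsto 0
    rw [sub_zero] at this
    exact this.mono_left nhdsWithin_le_nhds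
  have hXt := hX.self_of_nhds
  set g := lossGrad x y a with hg
  have hgc : Tendsto (fun h : ℝ => g (X t) - g (X (t - h))) (𝓝[>] 0) (𝓝 0) := by
    have h1 : ContinuousAt (fun s => g (X s)) t :=
      ContinuousAt.comp (continuousAt_lossGrad x y a (X t) hne) hXt.continuousAt
    have := (h1.tendsto.comp hm).const_sub (g (X t))
    simpa using this
  have hdq : Tendsto (fun h : ℝ => h⁻¹ • (X t - X (t - h))) (𝓝[>] 0) (𝓝 (X' t)) := by
    have h0 : Tendsto (fun h : ℝ => -h) (𝓝[>] 0) (𝓝[≠] 0) := by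
      refine tendsto_nhdsWithin_iff.2 ⟨?_, ?_⟩
      · have : Continuous (fun h : ℝ => -h) := by fun_prop
        have := this.tendsto 0
        rw [neg_zero] at this
        exact this.mono_left nhdsWithin_le_nhds
      · filter_upwards [self_mem_nhdsWithin] with h hh
        have : 0 < h := hh
        simpa using this.ne'
    have := (hasDerivAt_iff_tendsto_slope_zero.1 hXt).comp h0
    refine this.congr fun h => ?_
    simp only [Function.comp_apply, inv_neg, ← sub_eq_add_neg]
    module
  have hβ := tendsto_momentum (lam0 x)
  have hh0 : Tendsto (fun h : ℝ => h) (𝓝[>] 0) (𝓝 0) := tendsto_id.mono_left nhdsWithin_le_nhds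
  have hβ1 : Tendsto (fun h : ℝ => nagMomentum (lam0 x) (h ^ 2)) (𝓝[>] 0) (𝓝 1) := by
    have := (hh0.mul hβ).const_sub 1
    rw [zero_mul, sub_zero] at this
    refine this.congr' ?_
    filter_upwards [self_mem_nhdsWithin] with h hh
    have hh : h ≠ 0 := ne_of_gt hh
    field_simp
    ring
  have h2 := (tendsto_second_difference hX hX').mono_left
    (nhdsWithin_mono (0 : ℝ) (fun h (hh : h ∈ Ioi (0 : ℝ)) => (ne_of_gt hh : h ≠ 0)))
  -- The four terms of the scaled defect in the variable h; substituting h = √η and regrouping gives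
  -- the claim.
  have key := ((h2.add (hβ.smul hdq)).add_const (g (X t))).add (hβ1.smul hgc)
  rw [smul_zero, add_zero] at key
  refine (key.comp hsq).congr' ?_
  filter_upwards [self_mem_nhdsWithin] with η hη
  have hη : 0 < η := hη
  have hs : 0 < √η := Real.sqrt_pos.2 hη
  simp only [Function.comp_apply, Real.sq_sqrt hη.le, nagStep, nagHalf, ← hg]
  generalize nagMomentum (lam0 x) η = β
  have e : (√η)⁻¹ * (1 - β) * (√η)⁻¹ = η⁻¹ * (1 - β) := by
    rw [mul_right_comm, ← mul_inv, Real.mul_self_sqrt hη.le]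
  rw [smul_smul, e]
  have e2 : g (X t) = η⁻¹ • η • g (X t) := by
    rw [smul_smul, inv_mul_cancel₀ hη.ne', one_smul]
  have e3 : g (X t) - g (X (t - √η)) = η⁻¹ • η • (g (X t) - g (X (t - √η))) := by
    rw [smul_smul, inv_mul_cancel₀ hη.ne', one_smul]
  rw [e3]
  nth_rewrite 1 [e2]
  module

/-! ### Absolutely continuous functions -/

theorem absolutelyContinuous_const (c a b : ℝ) :
    AbsolutelyContinuousOnInterval (fun _ : ℝ => c) a b :=
  (contDiffOn_const (n := 1)).absolutelyContinuousOnInterval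

theorem absolutelyContinuous_finset_sum {ι : Type*} (s : Finset ι) {f : ι → ℝ → ℝ} {a b : ℝ}
    (hf : ∀ i ∈ s, AbsolutelyContinuousOnInterval (f i) a b) :
    AbsolutelyContinuousOnInterval (fun t => ∑ i ∈ s, f i t) a b := by
  classical
  induction s using Finset.induction_on with
  | empty => simpa using absolutelyContinuous_const 0 a b
  | insert j s hj ih =>
    simp only [Finset.sum_insert hj]
    exact (hf j (Finset.mem_insert_self j s)).fun_add
      (ih fun i hi => hf i (Finset.mem_insert_of_mem hi))

theorem absolutelyContinuous_exp (c a b : ℝ) :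
    AbsolutelyContinuousOnInterval (fun t : ℝ => Real.exp (c * t)) a b :=
  ContDiffOn.absolutelyContinuousOnInterval (by fun_prop)

/-- Comparison of an absolutely continuous function with a `C¹` function through their
derivatives. -/
theorem sub_le_sub_of_ae_deriv_le {f F F' : ℝ → ℝ} {T : ℝ} (hT : 0 ≤ T)
    (hf : AbsolutelyContinuousOnInterval f 0 T) (hF : ∀ t, HasDerivAt F (F' t) t)
    (hF' : Continuous F')
    (h : ∀ᵐ t : ℝ, t ∈ Icc 0 T → ∃ d, HasDerivAt f d t ∧ d ≤ F' t) :
    f T - f 0 ≤ F T - F 0 := by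
  rw [← hf.integral_deriv_eq_sub,
    ← intervalIntegral.integral_eq_sub_of_hasDerivAt (fun t _ => hF t)
      (hF'.intervalIntegrable 0 T)]
  refine intervalIntegral.integral_mono_ae_restrict hT hf.intervalIntegrable_deriv
    (hF'.intervalIntegrable 0 T) ?_
  refine (ae_restrict_iff' measurableSet_Icc).2 ?_
  filter_upwards [h] with t ht htI
  obtain ⟨d, hd, hle⟩ := ht htI
  rw [hd.deriv]
  exact hle

theorem relu_nonneg (z : ℝ) : 0 ≤ relu z := le_max_right _ _

theorem le_relu (z : ℝ) : z ≤ relu z := le_max_left _ _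

theorem lipschitzWith_relu : LipschitzWith 1 relu := by
  unfold relu
  exact LipschitzWith.id.max_const 0

/-- Chain rule for `relu ∘ u`: at a kink the derivative of `u` has to vanish, if `relu ∘ u` is
differentiable there. -/
theorem hasDerivAt_relu_comp {u : ℝ → ℝ} {d t s : ℝ} (hu : HasDerivAt u d t)
    (hr : DifferentiableAt ℝ (fun τ => relu (u τ)) t) (hs : s ∈ reluSubdiff (u t)) :
    HasDerivAt (fun τ => relu (u τ)) (s * d) t := by
  obtain ⟨-, -, hpos, hneg⟩ := hs
  rcases lt_trichotomy (u t) 0 with h | h | h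
  · rw [hneg h, zero_mul]
    have : (fun τ => relu (u τ)) =ᶠ[𝓝 t] fun _ => 0 := by
      filter_upwards [hu.continuousAt.eventually_lt continuousAt_const h] with τ hτ
      exact max_eq_right hτ.le
    exact (hasDerivAt_const t (0 : ℝ)).congr_of_eventuallyEq this
  · have hd := hr.hasDerivAt
    -- At a kink both relu ∘ u and relu ∘ u - u attain their minimum 0 at `t`, so both derivatives
    -- vanish, and hence so does `d`.
    have h0 : relu (u t) = 0 := by rw [h]; simp [relu]
    have m1 : IsLocalMin (fun τ => relu (u τ)) t :=
      Eventually.of_forall fun τ => by simpa [h0] using relu_nonneg (u τ)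
    have m2 : IsLocalMin (fun τ => relu (u τ) - u τ) t :=
      Eventually.of_forall fun τ => by
        change relu (u t) - u t ≤ relu (u τ) - u τ
        rw [h0, h, sub_zero]
        exact sub_nonneg.2 (le_relu (u τ))
    have e1 := m1.hasDerivAt_eq_zero hd
    have e2 := m2.hasDerivAt_eq_zero (hd.sub hu)
    rw [e1] at hd e2
    have : d = 0 := by linarith
    rwa [this, mul_zero]
  · rw [hpos h, one_mul]
    have : (fun τ => relu (u τ)) =ᶠ[𝓝 t] u := by
      filter_upwards [(continuousAt_const (y := (0 : ℝ))).eventually_lt hu.continuousAt h] with τ hτ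
      exact max_eq_left hτ.le
    exact hu.congr_of_eventuallyEq this

/-- The velocity is bounded on a compact interval. The Lipschitz bound survives composition with
ReLU, which makes the network output absolutely continuous along a trajectory. -/
theorem exists_lipschitzOnWith_of_deriv {u v : ℝ → ℝ} (hv : ContinuousOn v (Ici 0))
    (hu : ∀ t, 0 ≤ t → HasDerivWithinAt u (v t) (Ici 0) t) {T : ℝ} (hT : 0 ≤ T) :
    ∃ K, LipschitzOnWith K u (uIcc 0 T) := by
  rw [uIcc_of_le hT]
  obtain ⟨C, hC⟩ := isCompact_Icc.exists_bound_of_continuousOn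
    (hv.mono (Icc_subset_Ici_self : Icc 0 T ⊆ Ici 0))
  refine ⟨C.toNNReal, (convex_Icc 0 T).lipschitzOnWith_of_nnnorm_hasDerivWithin_le
    (fun t ht => (hu t ht.1).mono Icc_subset_Ici_self) fun t ht => ?_⟩
  rw [← NNReal.coe_le_coe, coe_nnnorm]
  exact (hC t ht).trans (Real.le_coe_toNNReal C)

theorem ae_ne_zero : ∀ᵐ t : ℝ, t ≠ 0 := by
  simp [ae_iff]

/-! ### Damped scalar equations with exponentially decaying forcing -/

/-- Duhamel bound for `v' + b v = O(exp (-b t / 4))`, `v 0 = 0`. -/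
theorem le_of_damped {v : ℝ → ℝ} {b c T : ℝ} (hb : 0 < b) (hT : 0 ≤ T)
    (hv : AbsolutelyContinuousOnInterval v 0 T) (h0 : v 0 = 0) (hc : 0 ≤ c)
    (h : ∀ᵐ t : ℝ, t ∈ Icc 0 T →
      ∃ d, HasDerivAt v d t ∧ d + b * v t ≤ c * Real.exp (-(b / 4) * t)) :
    v T ≤ 4 / (3 * b) * c * Real.exp (-(b / 4) * T) := by
  -- With the integrating factor exp(bt) the forcing becomes c exp(3bt/4), whose primitive carries
  -- the constant 4/(3b).
  have key := sub_le_sub_of_ae_deriv_le (f := fun t => Real.exp (b * t) * v t)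
    (F := fun t => 4 / (3 * b) * c * Real.exp (3 * b / 4 * t))
    (F' := fun t => c * Real.exp (3 * b / 4 * t)) hT
    ((absolutelyContinuous_exp b 0 T).fun_mul hv) (fun t => by
      have h1 : HasDerivAt (fun t : ℝ => 3 * b / 4 * t) (3 * b / 4) t := by
        simpa using (hasDerivAt_id t).const_mul (3 * b / 4)
      refine (h1.exp.const_mul (4 / (3 * b) * c)).congr_deriv ?_
      field_simp) (by fun_prop) (by
      filter_upwards [h] with t ht htI
      obtain ⟨d, hd, hle⟩ := ht htI
      have h1 : HasDerivAt (fun t : ℝ => b * t) b t := by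
        simpa using (hasDerivAt_id t).const_mul b
      refine ⟨_, h1.exp.mul hd, ?_⟩
      have e : c * Real.exp (3 * b / 4 * t)
          = Real.exp (b * t) * (c * Real.exp (-(b / 4) * t)) := by
        rw [mul_left_comm, ← Real.exp_add]
        ring_nf
      rw [e]
      have := mul_le_mul_of_nonneg_left hle (Real.exp_pos (b * t)).le
      linarith)
  simp only [h0, mul_zero, sub_zero, Real.exp_zero, mul_one] at key
  have hc' : 0 ≤ 4 / (3 * b) * c := by positivity
  have e : Real.exp (3 * b / 4 * T) = Real.exp (b * T) * Real.exp (-(b / 4) * T) := by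
    rw [← Real.exp_add]; ring_nf
  rw [e] at key
  have : Real.exp (b * T) * v T
      ≤ Real.exp (b * T) * (4 / (3 * b) * c * Real.exp (-(b / 4) * T)) := by linarith
  exact le_of_mul_le_mul_left this (Real.exp_pos _)

theorem abs_le_of_damped {v : ℝ → ℝ} {b c T : ℝ} (hb : 0 < b) (hT : 0 ≤ T)
    (hv : AbsolutelyContinuousOnInterval v 0 T) (h0 : v 0 = 0) (hc : 0 ≤ c)
    (h : ∀ᵐ t : ℝ, t ∈ Icc 0 T →
      ∃ d, HasDerivAt v d t ∧ |d + b * v t| ≤ c * Real.exp (-(b / 4) * t)) :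
    |v T| ≤ 4 / (3 * b) * c * Real.exp (-(b / 4) * T) := by
  refine abs_le'.2 ⟨le_of_damped hb hT hv h0 hc ?_,
    le_of_damped hb hT hv.fun_neg (by simpa using h0) hc ?_⟩
  · filter_upwards [h] with t ht htI
    obtain ⟨d, hd, hle⟩ := ht htI
    exact ⟨d, hd, (le_abs_self _).trans hle⟩
  · filter_upwards [h] with t ht htI
    obtain ⟨d, hd, hle⟩ := ht htI
    refine ⟨-d, hd.neg, le_trans ?_ hle⟩
    have := neg_abs_le (d + b * v t)
    linarith

/-- A curve whose velocity is `O(exp (-b t / 4))` stays close to its starting point. -/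
theorem abs_sub_le_of_exp_decay {u v : ℝ → ℝ} {b c T : ℝ} (hb : 0 < b) (hT : 0 ≤ T) (hc : 0 ≤ c)
    (hu : ∀ t ∈ Icc 0 T, HasDerivWithinAt u (v t) (Icc 0 T) t)
    (hv : ∀ t ∈ Icc 0 T, |v t| ≤ c * Real.exp (-(b / 4) * t)) :
    |u T - u 0| ≤ 4 / b * c := by
  have hE : ∀ t : ℝ, HasDerivAt (fun t : ℝ => -(4 / b * c) * Real.exp (-(b / 4) * t))
      (c * Real.exp (-(b / 4) * t)) t := fun t => by
    have h1 : HasDerivAt (fun t : ℝ => -(b / 4) * t) (-(b / 4)) t := by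
      simpa using (hasDerivAt_id t).const_mul (-(b / 4))
    refine (h1.exp.const_mul (-(4 / b * c))).congr_deriv ?_
    field_simp
  have key := image_norm_le_of_norm_deriv_right_le_deriv_boundary (a := 0) (b := T)
    (f := fun t => u t - u 0) (f' := v)
    (B := fun t => 4 / b * c + -(4 / b * c) * Real.exp (-(b / 4) * t))
    (B' := fun t => c * Real.exp (-(b / 4) * t))
    (fun t ht => ((hu t ht).continuousWithinAt).sub continuousWithinAt_const)
    (fun t ht => (((hu t (Ico_subset_Icc_self ht)).mono_of_mem_nhdsWithin
      (Icc_mem_nhdsGE_of_mem ht)).sub_const _))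
    (by simp) (fun t => (hE t).const_add _) (fun t ht => hv t (Ico_subset_Icc_self ht))
    (right_mem_Icc.2 hT)
  rw [Real.norm_eq_abs] at key
  have : 0 ≤ 4 / b * c * Real.exp (-(b / 4) * T) := by positivity
  linarith

/-! ### The quadratic Lyapunov function -/

open Matrix

theorem dotProduct_self_nonneg {n : ℕ} (v : Fin n → ℝ) : 0 ≤ v ⬝ᵥ v :=
  Finset.sum_nonneg fun i _ => mul_self_nonneg (v i)

/-- The inverse of a symmetric matrix that is bounded below by `μ > 0`. -/
theorem exists_inverse_of_coercive {n : ℕ} {A : Matrix (Fin n) (Fin n) ℝ} {μ : ℝ} (hμ : 0 < μ)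
    (hA : Aᵀ = A) (hpos : ∀ v, μ * (v ⬝ᵥ v) ≤ v ⬝ᵥ A *ᵥ v) :
    ∃ M : Matrix (Fin n) (Fin n) ℝ, Mᵀ = M ∧ M * A = 1 ∧ (∀ v, 0 ≤ v ⬝ᵥ M *ᵥ v) ∧
      ∀ v, v ⬝ᵥ M *ᵥ v ≤ μ⁻¹ * (v ⬝ᵥ v) := by
  have hPD : A.PosDef := by
    refine PosDef.of_dotProduct_mulVec_pos (by rw [IsHermitian, conjTranspose_eq_transpose_of_trivial, hA]) ?_
    intro v hv
    have h1 : 0 < v ⬝ᵥ v := by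
      refine lt_of_le_of_ne (dotProduct_self_nonneg v) fun h => hv ?_
      exact dotProduct_self_eq_zero.1 h.symm
    have := hpos v
    simp only [star_trivial]
    nlinarith
  have hu : IsUnit A.det := (isUnit_iff_isUnit_det A).1 hPD.isUnit
  refine ⟨A⁻¹, ?_, nonsing_inv_mul A hu, ?_, ?_⟩
  · rw [transpose_nonsing_inv, hA]
  · intro v
    simpa using hPD.inv.posSemidef.dotProduct_mulVec_nonneg v
  · intro v
    set w := A⁻¹ *ᵥ v with hw
    have hv : A *ᵥ w = v := by rw [hw, mulVec_mulVec, mul_nonsing_inv A hu, one_mulVec]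
    have h1 := hpos w
    rw [hv, dotProduct_comm w v] at h1
    -- With w = A⁻¹v, expanding |v - μw|² ≥ 0 and using μ|w|² ≤ v·w yields μ v·w ≤ |v|², without
    -- spectral theory.
    have h2 : 0 ≤ (v - μ • w) ⬝ᵥ (v - μ • w) := dotProduct_self_nonneg _
    simp only [sub_dotProduct, dotProduct_sub, smul_dotProduct, dotProduct_smul, smul_eq_mul,
      dotProduct_comm w v] at h2
    rw [inv_mul_eq_div, le_div_iff₀ hμ]
    nlinarith

/-- Derivative of `q ⬝ M q + Δ ⬝ Δ` along `q' = -(b/2) q - A Δ + g`, `Δ' = q - (b/2) Δ + ρ`, where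
`M = A⁻¹`. -/
theorem hasDerivAt_energy {n : ℕ} {A M : Matrix (Fin n) (Fin n) ℝ} (hM : Mᵀ = M) (hMA : M * A = 1)
    {q D : Fin n → ℝ → ℝ} {g ρ : Fin n → ℝ} {b t : ℝ}
    (hq : ∀ i, HasDerivAt (q i)
      (-(b / 2) * q i t - (A *ᵥ fun j => D j t) i + g i) t)
    (hD : ∀ i, HasDerivAt (D i) (q i t - b / 2 * D i t + ρ i) t) :
    HasDerivAt (fun τ => (fun i => q i τ) ⬝ᵥ M *ᵥ (fun i => q i τ)
        + (fun i => D i τ) ⬝ᵥ fun i => D i τ)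
      (-b * ((fun i => q i t) ⬝ᵥ M *ᵥ (fun i => q i t) + (fun i => D i t) ⬝ᵥ fun i => D i t)
        + 2 * (g ⬝ᵥ M *ᵥ fun i => q i t) + 2 * (ρ ⬝ᵥ fun i => D i t)) t := by
  set Q : Fin n → ℝ := fun i => q i t with hQ
  set Δ : Fin n → ℝ := fun i => D i t with hΔ
  set Q' : Fin n → ℝ := -(b / 2) • Q - A *ᵥ Δ + g with hQ'
  set Δ' : Fin n → ℝ := Q - (b / 2) • Δ + ρ with hΔ'
  have hq' : ∀ i, HasDerivAt (q i) (Q' i) t := fun i => by simpa [hQ', hQ, hΔ] using hq i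
  have hD' : ∀ i, HasDerivAt (D i) (Δ' i) t := fun i => by simpa [hΔ', hQ, hΔ] using hD i
  have h1 : HasDerivAt (fun τ => (fun i => q i τ) ⬝ᵥ M *ᵥ (fun i => q i τ)
        + (fun i => D i τ) ⬝ᵥ fun i => D i τ)
      ((Q' ⬝ᵥ M *ᵥ Q + Q ⬝ᵥ M *ᵥ Q') + (Δ' ⬝ᵥ Δ + Δ ⬝ᵥ Δ')) t := by
    have e1 : HasDerivAt (fun τ => ∑ i, q i τ * ∑ j, M i j * q j τ)
        (∑ i, (Q' i * (∑ j, M i j * Q j) + Q i * ∑ j, M i j * Q' j)) t :=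
      HasDerivAt.fun_sum fun i _ => (hq' i).mul
        (HasDerivAt.fun_sum fun j _ => (hq' j).const_mul _)
    have e2 : HasDerivAt (fun τ => ∑ i, D i τ * D i τ) (∑ i, (Δ' i * Δ i + Δ i * Δ' i)) t :=
      HasDerivAt.fun_sum fun i _ => (hD' i).mul (hD' i)
    rw [Finset.sum_add_distrib] at e1 e2
    exact e1.add e2
  refine h1.congr_deriv ?_
  have sym : ∀ v w : Fin n → ℝ, v ⬝ᵥ M *ᵥ w = w ⬝ᵥ M *ᵥ v := fun v w => by
    rw [dotProduct_mulVec, ← mulVec_transpose, hM, dotProduct_comm]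
  -- This is where the choice M = A⁻¹ pays off: the coupling -2 (AΔ)·MQ from `Q'` equals -2 Q·Δ and
  -- cancels the +2 Q·Δ from `Δ'`.
  have hAM : (A *ᵥ Δ) ⬝ᵥ M *ᵥ Q = Q ⬝ᵥ Δ := by
    rw [sym, mulVec_mulVec, hMA, one_mulVec]
  rw [sym Q Q', dotProduct_comm Δ Δ', hQ', hΔ']
  simp only [add_dotProduct, sub_dotProduct, smul_dotProduct, hAM, smul_eq_mul]
  ring

/-- Young's inequality for the perturbation terms of the energy balance. -/
theorem energy_young {n : ℕ} {M : Matrix (Fin n) (Fin n) ℝ} (hM : Mᵀ = M)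
    (hM0 : ∀ v, 0 ≤ v ⬝ᵥ M *ᵥ v) {b : ℝ} (hb : 0 < b) (Q Δ g ρ : Fin n → ℝ) :
    -b * (Q ⬝ᵥ M *ᵥ Q + Δ ⬝ᵥ Δ) + 2 * (g ⬝ᵥ M *ᵥ Q) + 2 * (ρ ⬝ᵥ Δ)
      ≤ -(3 * b / 4) * (Q ⬝ᵥ M *ᵥ Q + Δ ⬝ᵥ Δ) + 4 / b * (g ⬝ᵥ M *ᵥ g + ρ ⬝ᵥ ρ) := by
  have sym : ∀ v w : Fin n → ℝ, v ⬝ᵥ M *ᵥ w = w ⬝ᵥ M *ᵥ v := fun v w => by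
    rw [dotProduct_mulVec, ← mulVec_transpose, hM, dotProduct_comm]
  -- The squares are weighted so that exactly a quarter of the damping b is spent on the
  -- perturbation.
  have h1 := hM0 ((b / 4) • Q - g)
  have h2 : 0 ≤ ((b / 4) • Δ - ρ) ⬝ᵥ ((b / 4) • Δ - ρ) := dotProduct_self_nonneg _
  simp only [mulVec_sub, mulVec_smul, sub_dotProduct, dotProduct_sub, smul_dotProduct,
    dotProduct_smul, smul_eq_mul, sym Q g, dotProduct_comm Δ ρ] at h1 h2
  have hb' : 0 < 4 / b := by positivity
  have h3 := mul_nonneg hb'.le (add_nonneg h1 h2)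
  have e : 4 / b * (b / 4 * (b / 4 * (Q ⬝ᵥ M *ᵥ Q)) - b / 4 * (g ⬝ᵥ M *ᵥ Q)
      - (b / 4 * (g ⬝ᵥ M *ᵥ Q) - g ⬝ᵥ M *ᵥ g)
      + (b / 4 * (b / 4 * (Δ ⬝ᵥ Δ)) - b / 4 * (ρ ⬝ᵥ Δ) - (b / 4 * (ρ ⬝ᵥ Δ) - ρ ⬝ᵥ ρ)))
      = b / 4 * (Q ⬝ᵥ M *ᵥ Q + Δ ⬝ᵥ Δ) - 2 * (g ⬝ᵥ M *ᵥ Q) - 2 * (ρ ⬝ᵥ Δ)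
        + 4 / b * (g ⬝ᵥ M *ᵥ g + ρ ⬝ᵥ ρ) := by
    field_simp
    ring
  linarith

/-- Continuous induction: a continuous function that starts below `c` and cannot reach `c` stays
below `c`. -/
theorem lt_of_bootstrap {φ : ℝ → ℝ} {c : ℝ} (hφ : ContinuousOn φ (Ici 0)) (h0 : φ 0 < c)
    (h : ∀ T, 0 ≤ T → (∀ t ∈ Icc 0 T, φ t ≤ c) → φ T < c) {t : ℝ} (ht : 0 ≤ t) : φ t < c := by
  by_contra hc
  set Z : Set ℝ := Ici 0 ∩ φ ⁻¹' Ici c with hZ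
  have hcl : IsClosed Z := hφ.preimage_isClosed_of_isClosed isClosed_Ici isClosed_Ici
  have hbdd : BddBelow Z := ⟨0, fun s hs => hs.1⟩
  -- The infimum is the first time at which level `c` is reached; up to it the bound holds, so the
  -- hypothesis forbids reaching `c` there.
  have hmem : sInf Z ∈ Z := hcl.csInf_mem ⟨t, ht, not_lt.1 hc⟩ hbdd
  have hlt : ∀ s ∈ Ico 0 (sInf Z), φ s < c := by
    intro s hs
    by_contra hs'
    exact absurd (csInf_le hbdd ⟨hs.1, not_lt.1 hs'⟩) (not_le.2 hs.2)
  have hpos : 0 < sInf Z := by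
    refine lt_of_le_of_ne hmem.1 fun h' => ?_
    have := hmem.2
    rw [← h'] at this
    exact absurd h0 (not_lt.2 this)
  have hle : φ (sInf Z) ≤ c := by
    have hcl' : sInf Z ∈ closure (Ico 0 (sInf Z)) := by
      rw [closure_Ico hpos.ne]
      exact right_mem_Icc.2 hpos.le
    have := mem_closure_iff_nhdsWithin_neBot.1 hcl'
    refine le_of_tendsto ((hφ (sInf Z) hmem.1).mono (Ico_subset_Icc_self.trans
      Icc_subset_Ici_self) : Tendsto φ (𝓝[Ico 0 (sInf Z)] (sInf Z)) (𝓝 (φ (sInf Z)))) ?_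
    filter_upwards [self_mem_nhdsWithin] with s hs using (hlt s hs).le
  refine absurd (h (sInf Z) hmem.1 fun s hs => ?_) (not_lt.2 hmem.2)
  rcases hs.2.lt_or_eq with hs' | hs'
  · exact (hlt s ⟨hs.1, hs'⟩).le
  · rwa [hs']

/-! ### Reduction of a trajectory to scalar equations -/

theorem absolutelyContinuous_congr {f g : ℝ → ℝ} {a b : ℝ}
    (hf : AbsolutelyContinuousOnInterval f a b) (h : EqOn f g (uIcc a b)) :
    AbsolutelyContinuousOnInterval g a b := by
  refine Tendsto.congr' ?_ hf
  filter_upwards [mem_inf_of_right (mem_principal_self _)] with E hE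
  refine Finset.sum_congr rfl fun i hi => ?_
  have := hE.1 i hi
  rw [h this.1, h this.2]

/-- The scalar form of a heavy ball trajectory on `[0, T]`: for the pre-activations
`u r i = ⟪w_r, x_i⟫`, their velocities `v r i` and residuals `D i`, with `k` the Gram matrix of the
data. -/
structure IsScalarFlow (k : Fin n → Fin n → ℝ) (a : Fin m → ℝ) (b T : ℝ)
    (u v : Fin m → Fin n → ℝ → ℝ) (D : Fin n → ℝ → ℝ) : Prop where
  v_zero : ∀ r i, v r i 0 = 0
  hasDerivWithinAt_u : ∀ r i, ∀ t ∈ Icc 0 T, HasDerivWithinAt (u r i) (v r i t) (Icc 0 T) t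
  ac_v : ∀ r i, AbsolutelyContinuousOnInterval (v r i) 0 T
  ac_D : ∀ i, AbsolutelyContinuousOnInterval (D i) 0 T
  ae_deriv : ∀ᵐ t : ℝ, t ∈ Icc 0 T → ∃ s : Fin m → Fin n → ℝ,
    (∀ r i, s r i ∈ reluSubdiff (u r i t)) ∧
    (∀ r i, HasDerivAt (v r i)
      (-b * v r i t - ∑ j, D j t * (1 / √(m : ℝ) * a r * s r j * k j i)) t) ∧
    ∀ i, HasDerivAt (D i) (1 / √(m : ℝ) * ∑ r, a r * (s r i * v r i t)) t

/-- A heavy ball trajectory yields a scalar flow. -/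
theorem IsHBFlow.isScalarFlow {x : Fin n → EuclideanSpace ℝ (Fin p)} {y : Fin n → ℝ}
    {a : Fin m → ℝ} {b : ℝ} {W₀ : Weights m p} {W : ℝ → Weights m p}
    (h : IsHBFlow x y a b W₀ W) :
    ∃ V : ℝ → Weights m p, ∀ T, 0 ≤ T →
      IsScalarFlow (fun i j => inner ℝ (x i) (x j)) a b T (fun r i t => inner ℝ (W t r) (x i))
        (fun r i t => inner ℝ (V t r) (x i)) (fun i t => err x y a (W t) i) := by
  obtain ⟨-, V, G, hVc, hW, hG, hGmem, hV⟩ := h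
  refine ⟨V, fun T hT => ?_⟩
  set L : Fin m → Fin n → Weights m p →L[ℝ] ℝ := fun r i =>
    (innerSL ℝ (x i)).comp (ContinuousLinearMap.proj r) with hL
  have hLa : ∀ r i (w : Weights m p), L r i w = inner ℝ (w r) (x i) := fun r i w => by
    simp [hL, real_inner_comm]
  have hu : ∀ r i t, 0 ≤ t → HasDerivWithinAt (fun t => inner ℝ (W t r) (x i))
      (inner ℝ (V t r) (x i)) (Ici 0) t := fun r i t ht => by
    have := (L r i).hasFDerivAt.comp_hasDerivWithinAt t (hW t ht)
    simpa only [Function.comp_def, hLa] using this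
  have hvc : ∀ r i, ContinuousOn (fun t => inner ℝ (V t r) (x i)) (Ici 0) := fun r i => by
    have := (L r i).continuous.comp_continuousOn hVc
    simpa only [Function.comp_def, hLa] using this
  have hVint : ∀ t, 0 ≤ t → IntervalIntegrable V volume 0 t := fun t ht =>
    (hVc.mono (by rw [uIcc_of_le ht]; exact Icc_subset_Ici_self)).intervalIntegrable
  have hint : ∀ t, 0 ≤ t → IntervalIntegrable (fun s => b • V s + G s) volume 0 t :=
    fun t ht => ((hVint t ht).smul b).add (hG t ht)
  have hLint : ∀ r i t, 0 ≤ t →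
      IntervalIntegrable (fun s => L r i (b • V s + G s)) volume 0 t := fun r i t ht =>
    ⟨(L r i).integrable_comp (hint t ht).1, (L r i).integrable_comp (hint t ht).2⟩
  have hv : ∀ r i t, 0 ≤ t →
      inner ℝ (V t r) (x i) = -∫ s in (0 : ℝ)..t, L r i (b • V s + G s) := fun r i t ht => by
    rw [(L r i).intervalIntegral_comp_comm (hint t ht), ← map_neg, ← hV t ht, hLa]
  have hacv : ∀ r i, AbsolutelyContinuousOnInterval (fun t => inner ℝ (V t r) (x i)) 0 T := by
    intro r i
    have := ((hLint r i T hT).absolutelyContinuousOnInterval_intervalIntegral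
      (c := 0) left_mem_uIcc).neg
    exact absolutelyContinuous_congr this fun t ht => (hv r i t (by
      rw [uIcc_of_le hT] at ht; exact ht.1)).symm
  have hacr : ∀ r i, AbsolutelyContinuousOnInterval
      (fun t => relu (inner ℝ (W t r) (x i))) 0 T := fun r i => by
    obtain ⟨K, hK⟩ := exists_lipschitzOnWith_of_deriv (hvc r i) (hu r i) hT
    exact (lipschitzWith_relu.comp_lipschitzOnWith hK).absolutelyContinuousOnInterval
  refine ⟨fun r i => ?_, fun r i t ht => (hu r i t ht.1).mono Icc_subset_Ici_self, hacv, ?_, ?_⟩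
  · simp [hV 0 le_rfl]
  · intro i
    unfold err net
    exact ((absolutelyContinuous_finset_sum _ fun r _ => (hacr r i).const_mul (a r)).const_mul
      (1 / √(m : ℝ))).fun_sub (absolutelyContinuous_const (y i) 0 T)
  -- Almost every `t` is a differentiability point of all relu ∘ u and of all integrals giving the
  -- velocities. At such a `t` the selection `s` coming from the generalized gradient also serves in
  -- the chain rule for the residual, so a single `s` appears in both equations.
  · have h1 : ∀ᵐ t : ℝ, ∀ r i, t ∈ uIcc 0 T →
        DifferentiableAt ℝ (fun t => relu (inner ℝ (W t r) (x i))) t :=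
      ae_all_iff.2 fun r => ae_all_iff.2 fun i => (hacr r i).ae_differentiableAt
    have h2 : ∀ᵐ t : ℝ, ∀ r i, t ∈ uIcc 0 T → ∀ c ∈ uIcc 0 T,
        HasDerivAt (fun t => ∫ s in c..t, L r i (b • V s + G s)) (L r i (b • V t + G t)) t :=
      ae_all_iff.2 fun r => ae_all_iff.2 fun i => (hLint r i T hT).ae_hasDerivAt_integral
    filter_upwards [h1, h2, hGmem, ae_ne_zero] with t ht1 ht2 htG ht0 htI
    have htp : 0 < t := lt_of_le_of_ne htI.1 ht0.symm
    have htu : t ∈ uIcc 0 T := by rwa [uIcc_of_le hT]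
    obtain ⟨s, hs, hGs⟩ := htG htI.1
    refine ⟨s, hs, fun r i => ?_, fun i => ?_⟩
    · have := (ht2 r i htu 0 left_mem_uIcc).neg
      have h3 : (fun t => inner ℝ (V t r) (x i)) =ᶠ[𝓝 t]
          -fun t => ∫ s in (0 : ℝ)..t, L r i (b • V s + G s) := by
        filter_upwards [Ioi_mem_nhds htp] with τ hτ
        exact hv r i τ (le_of_lt hτ)
      refine (this.congr_of_eventuallyEq h3).congr_deriv ?_
      rw [hLa, Pi.add_apply, Pi.smul_apply, inner_add_left, real_inner_smul_left, hGs r,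
        sum_inner]
      simp only [real_inner_smul_left]
      rw [neg_add, neg_mul, sub_eq_add_neg]
    · have hud : ∀ r, HasDerivAt (fun t => inner ℝ (W t r) (x i)) (inner ℝ (V t r) (x i)) t :=
        fun r => (hu r i t htI.1).hasDerivAt (Ici_mem_nhds htp)
      unfold err net
      refine HasDerivAt.sub_const _ (HasDerivAt.const_mul _ ?_)
      exact HasDerivAt.fun_sum fun r _ =>
        (hasDerivAt_relu_comp (hud r) (ht1 r i htu) (hs r i)).const_mul (a r)

theorem IsScalarFlow.mono {k : Fin n → Fin n → ℝ} {a : Fin m → ℝ} {b T T' : ℝ}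
    {u v : Fin m → Fin n → ℝ → ℝ} {D : Fin n → ℝ → ℝ} (h : IsScalarFlow k a b T u v D)
    (h0 : 0 ≤ T') (hT : T' ≤ T) : IsScalarFlow k a b T' u v D := by
  have hsub : Icc 0 T' ⊆ Icc 0 T := Icc_subset_Icc_right hT
  have hsub' : uIcc 0 T' ⊆ uIcc 0 T := by rwa [uIcc_of_le h0, uIcc_of_le (h0.trans hT)]
  refine ⟨h.v_zero, fun r i t ht => (h.hasDerivWithinAt_u r i t (hsub ht)).mono hsub,
    fun r i => (h.ac_v r i).mono hsub', fun i => (h.ac_D i).mono hsub', ?_⟩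
  filter_upwards [h.ae_deriv] with t ht htI using ht (hsub htI)

theorem sum_abs_le_sqrt_card_mul {D : Fin n → ℝ} {c : ℝ} (hc : 0 ≤ c) (h : ∑ i, D i ^ 2 ≤ c ^ 2) :
    ∑ i, |D i| ≤ √(n : ℝ) * c := by
  refine abs_le_of_sq_le_sq' ?_ (by positivity) |>.2
  have := sq_sum_le_card_mul_sum_sq (s := Finset.univ) (f := fun i => |D i|)
  simp only [sq_abs, Finset.card_univ, Fintype.card_fin] at this
  rw [mul_pow, Real.sq_sqrt (Nat.cast_nonneg n)]
  exact this.trans (by gcongr)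

theorem abs_le_of_sum_sq_le {D : Fin n → ℝ} {c : ℝ} (hc : 0 ≤ c) (h : ∑ i, D i ^ 2 ≤ c ^ 2)
    (i : Fin n) : |D i| ≤ c := by
  refine abs_le_of_sq_le_sq ?_ hc
  exact (Finset.single_le_sum (f := fun i => D i ^ 2) (fun i _ => sq_nonneg _)
    (Finset.mem_univ i)).trans h

/-- The ℓ² norm of `N` is at most its ℓ¹ norm. Hence only the total number of near-kink pairs,
summed over the data points, has to be controlled. -/
theorem sum_sq_le_of_abs_le {ρ N : Fin n → ℝ} {c S : ℝ} (hN : ∀ i, 0 ≤ N i) (hS : ∑ i, N i ≤ S)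
    (hρ : ∀ i, |ρ i| ≤ N i * c) : ∑ i, ρ i ^ 2 ≤ S ^ 2 * c ^ 2 := by
  have h1 : ∑ i, ρ i ^ 2 ≤ (∑ i, N i ^ 2) * c ^ 2 := by
    rw [Finset.sum_mul]
    refine Finset.sum_le_sum fun i _ => ?_
    rw [← mul_pow, ← sq_abs]
    exact pow_le_pow_left₀ (abs_nonneg _) (hρ i) 2
  have h2 : ∑ i, N i ^ 2 ≤ (∑ i, N i) ^ 2 :=
    Finset.sum_sq_le_sq_sum_of_nonneg fun i _ => hN i
  have h3 : (∑ i, N i) ^ 2 ≤ S ^ 2 := pow_le_pow_left₀ (Finset.sum_nonneg fun i _ => hN i) hS 2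
  exact h1.trans (mul_le_mul_of_nonneg_right (h2.trans h3) (sq_nonneg c))

theorem abs_le_one_of_mem_reluSubdiff {z s : ℝ} (h : s ∈ reluSubdiff z) : |s| ≤ 1 :=
  abs_le.2 ⟨by linarith [h.1], h.2.1⟩

theorem reluDeriv_mem_Icc (z : ℝ) : 0 ≤ reluDeriv z ∧ reluDeriv z ≤ 1 := by
  unfold reluDeriv
  split_ifs <;> norm_num

/-- The activation pattern can only change where the initial pre-activation is small. -/
theorem abs_sub_reluDeriv_le {z z₀ R s : ℝ} (hs : s ∈ reluSubdiff z) (hz : |z - z₀| ≤ R) :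
    |s - reluDeriv z₀| ≤ if |z₀| ≤ R then 1 else 0 := by
  obtain ⟨h0, h1, hp, hn⟩ := hs
  obtain ⟨d0, d1⟩ := reluDeriv_mem_Icc z₀
  have hz' := abs_le.1 hz
  split_ifs with h
  · exact abs_le.2 ⟨by linarith, by linarith⟩
  · rw [not_le, lt_abs] at h
    rcases h with h | h
    · have hz0 : 0 ≤ z₀ := le_trans (le_trans (abs_nonneg _) hz) h.le
      rw [hp (by linarith), reluDeriv, if_pos hz0]
      simp
    · have hz0 : z₀ < 0 := by linarith [abs_nonneg (z - z₀)]
      rw [hn (by linarith), reluDeriv, if_neg (not_le.2 hz0)]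
      simp

/-! ### The lazy regime: a priori bounds and size of the perturbation -/

section Bootstrap

variable {k : Fin n → Fin n → ℝ} {a : Fin m → ℝ} {b T B : ℝ}
  {u v : Fin m → Fin n → ℝ → ℝ} {D : Fin n → ℝ → ℝ}

theorem exp_quarter_sq (b t : ℝ) :
    Real.exp (-(b / 4) * t) ^ 2 = Real.exp (-(b / 2) * t) := by
  rw [← Real.exp_nat_mul]
  ring_nf

/-- The force on one neuron is m^{-1/2} times a combination of residuals with coefficients at most
1. Cauchy–Schwarz bounds it by √n B exp(-bt/4)/√m, and the damped equation passes this decay on to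
the velocity. -/
theorem IsScalarFlow.abs_v_le (h : IsScalarFlow k a b T u v D) (hb : 0 < b)
    (ha : ∀ r, |a r| = 1) (hk : ∀ i j, |k i j| ≤ 1) (hB : 0 ≤ B)
    (hD : ∀ t ∈ Icc 0 T, ∑ i, D i t ^ 2 ≤ B ^ 2 * Real.exp (-(b / 2) * t))
    (r : Fin m) (i : Fin n) {t : ℝ} (ht : t ∈ Icc 0 T) :
    |v r i t| ≤ 4 / (3 * b) * (√(n : ℝ) * B / √(m : ℝ)) * Real.exp (-(b / 4) * t) := by
  have h' := h.mono ht.1 ht.2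
  refine abs_le_of_damped hb ht.1 (h'.ac_v r i) (h.v_zero r i) (by positivity) ?_
  filter_upwards [h'.ae_deriv] with τ hτ hτI
  obtain ⟨s, hs, hv, -⟩ := hτ hτI
  refine ⟨_, hv r i, ?_⟩
  have hDτ := hD τ ⟨hτI.1, hτI.2.trans ht.2⟩
  rw [← exp_quarter_sq, ← mul_pow] at hDτ
  have hsum := sum_abs_le_sqrt_card_mul (by positivity) hDτ
  rw [show -b * v r i τ - ∑ j, D j τ * (1 / √(m : ℝ) * a r * s r j * k j i) + b * v r i τ
    = -∑ j, D j τ * (1 / √(m : ℝ) * a r * s r j * k j i) by ring, abs_neg]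
  calc |∑ j, D j τ * (1 / √(m : ℝ) * a r * s r j * k j i)|
      ≤ ∑ j, |D j τ * (1 / √(m : ℝ) * a r * s r j * k j i)| := Finset.abs_sum_le_sum_abs _ _
    _ ≤ ∑ j, |D j τ| * (1 / √(m : ℝ)) := by
        refine Finset.sum_le_sum fun j _ => ?_
        rw [abs_mul]
        refine mul_le_mul_of_nonneg_left ?_ (abs_nonneg _)
        rw [abs_mul, abs_mul, abs_mul, ha r, mul_one, abs_of_nonneg (by positivity)]
        have h1 : |s r j| * |k j i| ≤ 1 :=
          mul_le_one₀ (abs_le_one_of_mem_reluSubdiff (hs r j)) (abs_nonneg _) (hk j i)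
        rw [mul_assoc]
        exact mul_le_of_le_one_right (by positivity) h1
    _ = (∑ j, |D j τ|) * (1 / √(m : ℝ)) := by rw [Finset.sum_mul]
    _ ≤ (√(n : ℝ) * (B * Real.exp (-(b / 4) * τ))) * (1 / √(m : ℝ)) := by gcongr
    _ = √(n : ℝ) * B / √(m : ℝ) * Real.exp (-(b / 4) * τ) := by ring

/-- Integrating the velocity bound over all times gives a displacement of order m^{-1/2}, uniformly
in time; this is laziness. -/
theorem IsScalarFlow.abs_u_sub_le (h : IsScalarFlow k a b T u v D) (hb : 0 < b)
    (ha : ∀ r, |a r| = 1) (hk : ∀ i j, |k i j| ≤ 1) (hB : 0 ≤ B)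
    (hD : ∀ t ∈ Icc 0 T, ∑ i, D i t ^ 2 ≤ B ^ 2 * Real.exp (-(b / 2) * t))
    (r : Fin m) (i : Fin n) {t : ℝ} (ht : t ∈ Icc 0 T) :
    |u r i t - u r i 0| ≤ 4 / b * (4 / (3 * b) * (√(n : ℝ) * B / √(m : ℝ))) := by
  have h' := h.mono ht.1 ht.2
  refine abs_sub_le_of_exp_decay hb ht.1 (by positivity) (h'.hasDerivWithinAt_u r i) ?_
  intro τ hτ
  exact h.abs_v_le hb ha hk hB hD r i ⟨hτ.1, hτ.2.trans ht.2⟩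

/-- Bound for the perturbation in the equation of the residual. -/
theorem sum_sq_velocity_perturbation_le (hm : 0 < m) (ha : ∀ r, |a r| = 1)
    {s s₀ ind w : Fin m → Fin n → ℝ} {σ c : ℝ}
    (hs : ∀ r i, |s r i - s₀ r i| ≤ ind r i) (hσ : ∑ i, ∑ r, ind r i ≤ σ * m)
    (hw : ∀ r i, |w r i| ≤ c / √(m : ℝ)) :
    ∑ i, (1 / √(m : ℝ) * ∑ r, a r * ((s r i - s₀ r i) * w r i)) ^ 2 ≤ σ ^ 2 * c ^ 2 := by
  have hm' : (0 : ℝ) < m := by exact_mod_cast hm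
  refine sum_sq_le_of_abs_le (N := fun i => (∑ r, ind r i) / m) (fun i => ?_) ?_ fun i => ?_
  · exact div_nonneg (Finset.sum_nonneg fun r _ => (abs_nonneg _).trans (hs r i)) hm'.le
  · rw [← Finset.sum_div, div_le_iff₀ hm']
    exact hσ
  · rw [abs_mul, abs_of_nonneg (by positivity)]
    have h1 : |∑ r, a r * ((s r i - s₀ r i) * w r i)| ≤ ∑ r, ind r i * (c / √(m : ℝ)) := by
      refine (Finset.abs_sum_le_sum_abs _ _).trans (Finset.sum_le_sum fun r _ => ?_)
      rw [abs_mul, abs_mul, ha r, one_mul]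
      exact mul_le_mul (hs r i) (hw r i) (abs_nonneg _) ((abs_nonneg _).trans (hs r i))
    calc 1 / √(m : ℝ) * |∑ r, a r * ((s r i - s₀ r i) * w r i)|
        ≤ 1 / √(m : ℝ) * ∑ r, ind r i * (c / √(m : ℝ)) := by gcongr
      _ = (∑ r, ind r i) / (√(m : ℝ) * √(m : ℝ)) * c := by
        rw [← Finset.sum_mul]
        field_simp
      _ = (∑ r, ind r i) / m * c := by rw [Real.mul_self_sqrt hm'.le]

/-- Bound for the perturbation in the equation of the velocity. -/
theorem sum_sq_kernel_perturbation_le (hm : 0 < m) (hk : ∀ i j, |k i j| ≤ 1)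
    {s s₀ ind : Fin m → Fin n → ℝ} {d : Fin n → ℝ} {σ c : ℝ} (hc : 0 ≤ c)
    (hs₀ : ∀ r i, |s₀ r i| ≤ 1)
    (hs : ∀ r i, |s r i - s₀ r i| ≤ ind r i) (hσ : ∑ i, ∑ r, ind r i ≤ σ * m)
    (hd : ∀ j, |d j| ≤ c) :
    ∑ i, (∑ j, d j * (k j i * (1 / (m : ℝ) * ∑ r, s₀ r i * (s r j - s₀ r j)))) ^ 2
      ≤ n * σ ^ 2 * c ^ 2 := by
  have hm' : (0 : ℝ) < m := by exact_mod_cast hm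
  have h1 : ∀ i, |∑ j, d j * (k j i * (1 / (m : ℝ) * ∑ r, s₀ r i * (s r j - s₀ r j)))|
      ≤ σ * c := by
    intro i
    calc |∑ j, d j * (k j i * (1 / (m : ℝ) * ∑ r, s₀ r i * (s r j - s₀ r j)))|
        ≤ ∑ j, c * (1 / (m : ℝ) * ∑ r, ind r j) := by
          refine (Finset.abs_sum_le_sum_abs _ _).trans (Finset.sum_le_sum fun j _ => ?_)
          have e : |∑ r, s₀ r i * (s r j - s₀ r j)| ≤ ∑ r, ind r j := by
            refine (Finset.abs_sum_le_sum_abs _ _).trans (Finset.sum_le_sum fun r _ => ?_)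
            rw [abs_mul]
            exact (mul_le_of_le_one_left (abs_nonneg _) (hs₀ r i)).trans (hs r j)
          rw [abs_mul, abs_mul, abs_mul, abs_of_nonneg (a := 1 / (m : ℝ)) (by positivity)]
          refine mul_le_mul (hd j) ?_ (by positivity) hc
          refine (mul_le_of_le_one_left (by positivity) (hk j i)).trans ?_
          gcongr
      _ = c * ((∑ j, ∑ r, ind r j) / m) := by
          rw [← Finset.mul_sum, ← Finset.mul_sum]
          ring
      _ ≤ c * σ := by
          gcongr
          rwa [div_le_iff₀ hm']
      _ = σ * c := mul_comm _ _
  calc ∑ i, (∑ j, d j * (k j i * (1 / (m : ℝ) * ∑ r, s₀ r i * (s r j - s₀ r j)))) ^ 2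
      ≤ ∑ _i : Fin n, (σ * c) ^ 2 := by
        refine Finset.sum_le_sum fun i _ => ?_
        rw [← sq_abs]
        exact pow_le_pow_left₀ (abs_nonneg _) (h1 i) 2
    _ = n * σ ^ 2 * c ^ 2 := by
        simp
        ring

end Bootstrap

section Bootstrap

variable {k : Fin n → Fin n → ℝ} {a : Fin m → ℝ} {b T B lam : ℝ}
  {u v : Fin m → Fin n → ℝ → ℝ} {D : Fin n → ℝ → ℝ}

/-- The equations of motion, written as a perturbation of the linear oscillator whose kernel is
frozen at the initial activation pattern `s₀`. -/
theorem hasDerivAt_frozen (hm : 0 < m) (ha : ∀ r, |a r| = 1) (hksymm : ∀ i j, k i j = k j i)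
    (hb2 : b ^ 2 = 2 * lam) {s s₀ : Fin m → Fin n → ℝ} {H : Matrix (Fin n) (Fin n) ℝ}
    (hH : ∀ i j, H i j = 1 / (m : ℝ) * ∑ r, s₀ r i * s₀ r j * k i j) {t : ℝ}
    (hv : ∀ r i, HasDerivAt (v r i)
      (-b * v r i t - ∑ j, D j t * (1 / √(m : ℝ) * a r * s r j * k j i)) t)
    (hD : ∀ i, HasDerivAt (D i) (1 / √(m : ℝ) * ∑ r, a r * (s r i * v r i t)) t)
    {q : Fin n → ℝ → ℝ}
    (hq : ∀ i τ, q i τ = 1 / √(m : ℝ) * ∑ r, a r * (s₀ r i * v r i τ) + b / 2 * D i τ)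
    {ρ₁ ρ₂ : Fin n → ℝ}
    (hρ₁ : ∀ i, ρ₁ i = 1 / √(m : ℝ) * ∑ r, a r * ((s r i - s₀ r i) * v r i t))
    (hρ₂ : ∀ i, ρ₂ i = ∑ j, D j t * (k j i * (1 / (m : ℝ) * ∑ r, s₀ r i * (s r j - s₀ r j)))) :
    (∀ i, HasDerivAt (q i) (-(b / 2) * q i t
      - ((H - (lam / 2) • (1 : Matrix (Fin n) (Fin n) ℝ)) *ᵥ fun j => D j t) i
      + (b / 2 * ρ₁ i - ρ₂ i)) t) ∧
    ∀ i, HasDerivAt (D i) (q i t - b / 2 * D i t + ρ₁ i) t := by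
  have hm' : (0 : ℝ) < m := by exact_mod_cast hm
  have hDi : ∀ i, 1 / √(m : ℝ) * ∑ r, a r * (s r i * v r i t)
      = q i t - b / 2 * D i t + ρ₁ i := by
    intro i
    rw [hq, hρ₁, add_sub_cancel_right, ← mul_add, ← Finset.sum_add_distrib]
    congr 1
    exact Finset.sum_congr rfl fun r _ => by ring
  refine ⟨fun i => ?_, fun i => (hD i).congr_deriv (hDi i)⟩
  have h1 : HasDerivAt (fun τ => 1 / √(m : ℝ) * ∑ r, a r * (s₀ r i * v r i τ) + b / 2 * D i τ)
      (1 / √(m : ℝ) * ∑ r, a r * (s₀ r i *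
        (-b * v r i t - ∑ j, D j t * (1 / √(m : ℝ) * a r * s r j * k j i)))
        + b / 2 * (q i t - b / 2 * D i t + ρ₁ i)) t :=
    (HasDerivAt.const_mul _ (HasDerivAt.fun_sum fun r _ =>
      ((hv r i).const_mul _).const_mul _)).add (((hD i).congr_deriv (hDi i)).const_mul _)
  have hqi : q i = fun τ => 1 / √(m : ℝ) * ∑ r, a r * (s₀ r i * v r i τ) + b / 2 * D i τ :=
    funext (hq i)
  rw [← hqi] at h1
  refine h1.congr_deriv ?_
  -- Since a_r² = 1, differentiating the frozen velocity produces a mixed kernel with one frozen and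
  -- one current pattern; `e4` splits it into H and `ρ₂`.
  have e1 : 1 / √(m : ℝ) * ∑ r, a r * (s₀ r i *
        (-b * v r i t - ∑ j, D j t * (1 / √(m : ℝ) * a r * s r j * k j i)))
      = -b * (1 / √(m : ℝ) * ∑ r, a r * (s₀ r i * v r i t))
        - ∑ j, D j t * (k j i * (1 / (m : ℝ) * ∑ r, s₀ r i * s r j)) := by
    have e2 : ∀ r, a r * (s₀ r i *
        (-b * v r i t - ∑ j, D j t * (1 / √(m : ℝ) * a r * s r j * k j i)))
        = -b * (a r * (s₀ r i * v r i t))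
          - ∑ j, 1 / √(m : ℝ) * (D j t * (k j i * (s₀ r i * s r j))) := by
      intro r
      have har : a r * a r = 1 := by rw [← abs_mul_abs_self, ha r, one_mul]
      rw [mul_sub, mul_sub, Finset.mul_sum, Finset.mul_sum]
      congr 1
      · ring
      · refine Finset.sum_congr rfl fun j _ => ?_
        linear_combination (s₀ r i * D j t * (1 / √(m : ℝ)) * s r j * k j i) * har
    simp only [e2, Finset.sum_sub_distrib]
    rw [Finset.sum_comm, mul_sub, ← Finset.mul_sum]
    congr 1
    · ring
    · rw [Finset.mul_sum]
      refine Finset.sum_congr rfl fun j _ => ?_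
      simp only [← Finset.mul_sum]
      have : 1 / √(m : ℝ) * (1 / √(m : ℝ)) = 1 / (m : ℝ) := by
        rw [div_mul_div_comm, one_mul, Real.mul_self_sqrt hm'.le]
      linear_combination (D j t * (k j i * ∑ r, s₀ r i * s r j)) * this
  have e3 : ((H - (lam / 2) • (1 : Matrix (Fin n) (Fin n) ℝ)) *ᵥ fun j => D j t) i
      = ∑ j, D j t * (k j i * (1 / (m : ℝ) * ∑ r, s₀ r i * s₀ r j)) - lam / 2 * D i t := by
    rw [sub_mulVec, smul_mulVec, one_mulVec, Pi.sub_apply, Pi.smul_apply, smul_eq_mul]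
    congr 1
    change ∑ j, H i j * D j t = _
    refine Finset.sum_congr rfl fun j _ => ?_
    rw [hH, ← Finset.sum_mul, hksymm i j]
    ring
  have e4 : ∑ j, D j t * (k j i * (1 / (m : ℝ) * ∑ r, s₀ r i * s r j))
      = ∑ j, D j t * (k j i * (1 / (m : ℝ) * ∑ r, s₀ r i * s₀ r j)) + ρ₂ i := by
    rw [hρ₂, ← Finset.sum_add_distrib]
    refine Finset.sum_congr rfl fun j _ => ?_
    rw [← mul_add, ← mul_add, ← mul_add, ← Finset.sum_add_distrib]
    simp only [← mul_add, add_sub_cancel]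
  -- Completing the square in q contributes (b²/4)Δ = (λ/2)Δ, which shifts H to H - λ/2.
  have hqt := hq i t
  rw [e1, e3, e4]
  linear_combination b * hqt + (1 / 4) * D i t * hb2

/-- The forcing g = (b/2)ρ₁ - ρ₂ satisfies |g|² ≤ λ|ρ₁|² + 2|ρ₂|², and M costs a factor 8/(3λ). The
total constant is 13/432 + 1/288 = 29/864, just below 1/28. -/
theorem sq_le_of_perturbation {ρ₁ ρ₂ : Fin n → ℝ} {M : Matrix (Fin n) (Fin n) ℝ} {c : ℝ}
    (hlam : 0 < lam) (hb2 : b ^ 2 = 2 * lam)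
    (hM : ∀ w, w ⬝ᵥ M *ᵥ w ≤ (3 / 8 * lam)⁻¹ * (w ⬝ᵥ w))
    (h₁ : ∑ i, ρ₁ i ^ 2 ≤ lam / 288 * c) (h₂ : ∑ i, ρ₂ i ^ 2 ≤ lam ^ 2 / 256 * c) (hc : 0 ≤ c) :
    (fun i => b / 2 * ρ₁ i - ρ₂ i) ⬝ᵥ M *ᵥ (fun i => b / 2 * ρ₁ i - ρ₂ i) + ρ₁ ⬝ᵥ ρ₁
      ≤ lam / 28 * c := by
  have h3 : (fun i => b / 2 * ρ₁ i - ρ₂ i) ⬝ᵥ (fun i => b / 2 * ρ₁ i - ρ₂ i)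
      ≤ lam * ∑ i, ρ₁ i ^ 2 + 2 * ∑ i, ρ₂ i ^ 2 := by
    rw [Finset.mul_sum, Finset.mul_sum, ← Finset.sum_add_distrib]
    refine Finset.sum_le_sum fun i _ => ?_
    have : lam * ρ₁ i ^ 2 + 2 * ρ₂ i ^ 2
        - (b / 2 * ρ₁ i - ρ₂ i) * (b / 2 * ρ₁ i - ρ₂ i) = (b / 2 * ρ₁ i + ρ₂ i) ^ 2 := by
      linear_combination (-(1 / 2) * ρ₁ i ^ 2) * hb2
    nlinarith [sq_nonneg (b / 2 * ρ₁ i + ρ₂ i)]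
  have h4 : ρ₁ ⬝ᵥ ρ₁ = ∑ i, ρ₁ i ^ 2 := Finset.sum_congr rfl fun i _ => (sq _).symm
  have h5 : lam * ∑ i, ρ₁ i ^ 2 + 2 * ∑ i, ρ₂ i ^ 2 ≤ lam ^ 2 * (13 / 1152) * c := by
    have := mul_le_mul_of_nonneg_left h₁ hlam.le
    nlinarith
  have h6 : (3 / 8 * lam)⁻¹ * (lam ^ 2 * (13 / 1152) * c) = lam * (13 / 432) * c := by
    field_simp
    ring
  have h7 : (3 / 8 * lam)⁻¹ * ((fun i => b / 2 * ρ₁ i - ρ₂ i) ⬝ᵥ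
      (fun i => b / 2 * ρ₁ i - ρ₂ i)) ≤ lam * (13 / 432) * c := by
    rw [← h6]
    exact mul_le_mul_of_nonneg_left (h3.trans h5) (by positivity)
  have h8 : 0 ≤ lam * c := by positivity
  rw [h4]
  linarith [hM fun i => b / 2 * ρ₁ i - ρ₂ i]

/-- The energy balance at a point of differentiability, under the exponential bound on the
residual. -/
theorem IsScalarFlow.energy_deriv_le (h : IsScalarFlow k a b T u v D) (hm : 0 < m)
    (ha : ∀ r, |a r| = 1) (hk : ∀ i j, |k i j| ≤ 1) (hksymm : ∀ i j, k i j = k j i)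
    (hlam : 0 < lam) (hb : 0 < b) (hb2 : b ^ 2 = 2 * lam) {H M : Matrix (Fin n) (Fin n) ℝ}
    (hH : ∀ i j, H i j
      = 1 / (m : ℝ) * ∑ r, reluDeriv (u r i 0) * reluDeriv (u r j 0) * k i j)
    (hM : Mᵀ = M) (hMA : M * (H - (lam / 2) • (1 : Matrix (Fin n) (Fin n) ℝ)) = 1)
    (hM0 : ∀ w, 0 ≤ w ⬝ᵥ M *ᵥ w) (hMle : ∀ w, w ⬝ᵥ M *ᵥ w ≤ (3 / 8 * lam)⁻¹ * (w ⬝ᵥ w))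
    {R σ : ℝ} (hB : 0 < B)
    (hR : 8 / (3 * lam) * (√(n : ℝ) * B) ≤ R * √(m : ℝ))
    (hσ : ∑ i, ∑ r, (if |u r i 0| ≤ R then (1 : ℝ) else 0) ≤ σ * m)
    (hσ' : n * σ ^ 2 ≤ lam ^ 2 / 256)
    (hD : ∀ t ∈ Icc 0 T, ∑ i, D i t ^ 2 ≤ B ^ 2 * Real.exp (-(b / 2) * t))
    {q : Fin n → ℝ → ℝ}
    (hq : ∀ i τ, q i τ
      = 1 / √(m : ℝ) * ∑ r, a r * (reluDeriv (u r i 0) * v r i τ) + b / 2 * D i τ)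
    {t : ℝ} (htI : t ∈ Icc 0 T) {s : Fin m → Fin n → ℝ}
    (hs : ∀ r i, s r i ∈ reluSubdiff (u r i t))
    (hv : ∀ r i, HasDerivAt (v r i)
      (-b * v r i t - ∑ j, D j t * (1 / √(m : ℝ) * a r * s r j * k j i)) t)
    (hDd : ∀ i, HasDerivAt (D i) (1 / √(m : ℝ) * ∑ r, a r * (s r i * v r i t)) t) :
    ∃ d, HasDerivAt (fun τ => (fun i => q i τ) ⬝ᵥ M *ᵥ (fun i => q i τ)
        + (fun i => D i τ) ⬝ᵥ fun i => D i τ) d t ∧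
      d ≤ -(3 * b / 4) * ((fun i => q i t) ⬝ᵥ M *ᵥ (fun i => q i t)
        + (fun i => D i t) ⬝ᵥ fun i => D i t) + b / 14 * (B ^ 2 * Real.exp (-(b / 2) * t)) := by
  have hm' : (0 : ℝ) < m := by exact_mod_cast hm
  set s₀ : Fin m → Fin n → ℝ := fun r i => reluDeriv (u r i 0)
  have hs₀1 : ∀ r i, |s₀ r i| ≤ 1 := fun r i => by
    have := reluDeriv_mem_Icc (u r i 0)
    rw [abs_of_nonneg this.1]
    exact this.2
  set ρ₁ : Fin n → ℝ := fun i =>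
    1 / √(m : ℝ) * ∑ r, a r * ((s r i - s₀ r i) * v r i t)
  set ρ₂ : Fin n → ℝ := fun i =>
    ∑ j, D j t * (k j i * (1 / (m : ℝ) * ∑ r, s₀ r i * (s r j - s₀ r j)))
  obtain ⟨hq', hD'⟩ := hasDerivAt_frozen (s₀ := s₀) (ρ₁ := ρ₁) (ρ₂ := ρ₂) hm ha hksymm hb2 hH hv
    hDd hq (fun i => rfl) (fun i => rfl)
  refine ⟨_, hasDerivAt_energy hM hMA hq' hD', ?_⟩
  have hflip : ∀ r i, |s r i - s₀ r i| ≤ if |u r i 0| ≤ R then (1 : ℝ) else 0 := by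
    intro r i
    refine abs_sub_reluDeriv_le (hs r i) ((h.abs_u_sub_le hb ha hk hB.le hD r i htI).trans ?_)
    have hsm : 0 < √(m : ℝ) := Real.sqrt_pos.2 hm'
    -- The displacement constant 16/(3b²) is 8/(3λ), which is the left side of `hR`.
    have e : 4 / b * (4 / (3 * b) * (√(n : ℝ) * B / √(m : ℝ)))
        = 8 / (3 * lam) * (√(n : ℝ) * B) / √(m : ℝ) := by
      field_simp
      rw [hb2]
      ring
    rw [e, div_le_iff₀ hsm]
    exact hR
  have hee := exp_quarter_sq b t
  rw [← hee]
  set e := Real.exp (-(b / 4) * t)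
  have he : 0 < e := Real.exp_pos _
  have hρ₁ : ∑ i, ρ₁ i ^ 2 ≤ lam / 288 * (B ^ 2 * e ^ 2) := by
    refine (sum_sq_velocity_perturbation_le (c := 4 / (3 * b) * (√(n : ℝ) * B) * e) hm ha
      hflip hσ fun r i => ?_).trans ?_
    · refine (h.abs_v_le hb ha hk hB.le hD r i htI).trans (le_of_eq ?_)
      ring
    · have e1 : σ ^ 2 * (4 / (3 * b) * (√(n : ℝ) * B) * e) ^ 2
          = (n * σ ^ 2) * (8 / (9 * lam) * (B ^ 2 * e ^ 2)) := by
        rw [mul_pow, mul_pow, mul_pow, div_pow, mul_pow, hb2, Real.sq_sqrt (Nat.cast_nonneg n)]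
        field_simp
        ring
      have e2 : lam / 288 * (B ^ 2 * e ^ 2)
          = (lam ^ 2 / 256) * (8 / (9 * lam) * (B ^ 2 * e ^ 2)) := by
        field_simp
        norm_num
      rw [e1, e2]
      exact mul_le_mul_of_nonneg_right hσ' (by positivity)
  have hρ₂ : ∑ i, ρ₂ i ^ 2 ≤ lam ^ 2 / 256 * (B ^ 2 * e ^ 2) := by
    refine (sum_sq_kernel_perturbation_le (c := B * e) hm hk (by positivity) hs₀1
      hflip hσ fun j => ?_).trans ?_
    · refine abs_le_of_sum_sq_le (D := fun j => D j t) (by positivity) ?_ j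
      rw [mul_pow, hee]
      exact hD t htI
    · rw [mul_pow]
      exact mul_le_mul_of_nonneg_right hσ' (by positivity)
  have hpert := sq_le_of_perturbation hlam hb2 hMle hρ₁ hρ₂ (by positivity)
  have hy := energy_young hM hM0 hb (fun i => q i t) (fun i => D i t)
    (fun i => b / 2 * ρ₁ i - ρ₂ i) ρ₁
  have hpert' := mul_le_mul_of_nonneg_left hpert (by positivity : 0 ≤ 4 / b)
  -- As λ = b²/2, Young's factor 4/b turns λ/28 into b/14.
  have e3 : 4 / b * (lam / 28 * (B ^ 2 * e ^ 2)) = b / 14 * (B ^ 2 * e ^ 2) := by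
    field_simp
    linear_combination (-28 : ℝ) * hb2
  rw [e3] at hpert'
  exact hy.trans (add_le_add_right hpert' _)

theorem absolutelyContinuous_energy {q : Fin n → ℝ → ℝ} (M : Matrix (Fin n) (Fin n) ℝ) {c d : ℝ}
    (hq : ∀ i, AbsolutelyContinuousOnInterval (q i) c d)
    (hD : ∀ i, AbsolutelyContinuousOnInterval (D i) c d) :
    AbsolutelyContinuousOnInterval (fun τ => (fun i => q i τ) ⬝ᵥ M *ᵥ (fun i => q i τ)
        + (fun i => D i τ) ⬝ᵥ fun i => D i τ) c d := by
  have e1 : AbsolutelyContinuousOnInterval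
      (fun τ => ∑ i, q i τ * ∑ j, M i j * q j τ) c d :=
    absolutelyContinuous_finset_sum _ fun i _ => (hq i).fun_mul
      (absolutelyContinuous_finset_sum _ fun j _ => (hq j).const_mul _)
  have e2 : AbsolutelyContinuousOnInterval (fun τ => ∑ i, D i τ * D i τ) c d :=
    absolutelyContinuous_finset_sum _ fun i _ => (hD i).fun_mul (hD i)
  exact e1.fun_add e2

/-- If the residual obeys the exponential bound up to time `T`, it obeys it strictly at `T`. -/
theorem IsScalarFlow.bootstrap_step (h : IsScalarFlow k a b T u v D) (hT : 0 ≤ T) (hm : 0 < m)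
    (ha : ∀ r, |a r| = 1) (hk : ∀ i j, |k i j| ≤ 1) (hksymm : ∀ i j, k i j = k j i)
    (hlam : 0 < lam) (hb : 0 < b) (hb2 : b ^ 2 = 2 * lam) {H : Matrix (Fin n) (Fin n) ℝ}
    (hH : ∀ i j, H i j
      = 1 / (m : ℝ) * ∑ r, reluDeriv (u r i 0) * reluDeriv (u r j 0) * k i j)
    (hpos : ∀ w, 7 / 8 * lam * (w ⬝ᵥ w) ≤ w ⬝ᵥ H *ᵥ w) {R σ : ℝ} (hB : 0 < B)
    (hR : 8 / (3 * lam) * (√(n : ℝ) * B) ≤ R * √(m : ℝ))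
    (hσ : ∑ i, ∑ r, (if |u r i 0| ≤ R then (1 : ℝ) else 0) ≤ σ * m)
    (hσ' : n * σ ^ 2 ≤ lam ^ 2 / 256) (h0 : 7 / 2 * ∑ i, D i 0 ^ 2 ≤ B ^ 2)
    (hD : ∀ t ∈ Icc 0 T, ∑ i, D i t ^ 2 ≤ B ^ 2 * Real.exp (-(b / 2) * t)) :
    ∑ i, D i T ^ 2 < B ^ 2 * Real.exp (-(b / 2) * T) := by
  have hm' : (0 : ℝ) < m := by exact_mod_cast hm
  set A : Matrix (Fin n) (Fin n) ℝ := H - (lam / 2) • (1 : Matrix (Fin n) (Fin n) ℝ) with hA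
  have hAt : Aᵀ = A := by
    rw [hA, transpose_sub, transpose_smul, transpose_one]
    congr 1
    ext i j
    rw [transpose_apply, hH, hH, hksymm j i]
    congr 1
    exact Finset.sum_congr rfl fun r _ => by ring
  -- The constant 3/8 is 7/8 - 1/2: the coercivity of H minus the shift.
  obtain ⟨M, hM, hMA, hM0, hMle⟩ := exists_inverse_of_coercive (A := A) (μ := 3 / 8 * lam)
    (by positivity) hAt fun w => by
      rw [hA, sub_mulVec, smul_mulVec, one_mulVec, dotProduct_sub, dotProduct_smul, smul_eq_mul]
      linarith [hpos w]
  obtain ⟨q, hq⟩ : ∃ q : Fin n → ℝ → ℝ, ∀ i τ, q i τ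
      = 1 / √(m : ℝ) * ∑ r, a r * (reluDeriv (u r i 0) * v r i τ) + b / 2 * D i τ :=
    ⟨_, fun _ _ => rfl⟩
  set E : ℝ → ℝ := fun τ => (fun i => q i τ) ⬝ᵥ M *ᵥ (fun i => q i τ)
        + (fun i => D i τ) ⬝ᵥ fun i => D i τ with hE
  have hDD : ∀ t, (fun i => D i t) ⬝ᵥ (fun i => D i t) = ∑ i, D i t ^ 2 := fun t =>
    Finset.sum_congr rfl fun i _ => (sq _).symm
  -- The flow starts at rest, so q(0) = (b/2)Δ(0) and E(0) ≤ (4/3 + 1)|Δ(0)|²; with (7/2)|Δ(0)|² ≤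
  -- B² this gives 2/3.
  have hE0 : E 0 ≤ 2 / 3 * B ^ 2 := by
    have e : (fun i => q i 0) = (b / 2) • fun i => D i 0 := by
      ext i
      simp [hq, h.v_zero]
    have h1 := hMle fun i => D i 0
    rw [hDD] at h1
    simp only [hE, e, mulVec_smul, smul_dotProduct, dotProduct_smul, smul_eq_mul, hDD]
    have h2 : b / 2 * (b / 2 * ((fun i => D i 0) ⬝ᵥ M *ᵥ fun i => D i 0))
        ≤ lam / 2 * ((3 / 8 * lam)⁻¹ * ∑ i, D i 0 ^ 2) := by
      calc b / 2 * (b / 2 * ((fun i => D i 0) ⬝ᵥ M *ᵥ fun i => D i 0))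
          = lam / 2 * ((fun i => D i 0) ⬝ᵥ M *ᵥ fun i => D i 0) := by
            linear_combination (((fun i => D i 0) ⬝ᵥ M *ᵥ fun i => D i 0) / 4) * hb2
        _ ≤ _ := mul_le_mul_of_nonneg_left h1 (by positivity)
    have h3 : lam / 2 * ((3 / 8 * lam)⁻¹ * ∑ i, D i 0 ^ 2) = 4 / 3 * ∑ i, D i 0 ^ 2 := by
      field_simp
      ring
    linarith
  have hacq : ∀ i, AbsolutelyContinuousOnInterval (q i) 0 T := fun i => by
    rw [funext (hq i)]
    exact ((absolutelyContinuous_finset_sum _ fun r _ =>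
      ((h.ac_v r i).const_mul _).const_mul _).const_mul _).fun_add ((h.ac_D i).const_mul _)
  have hacE : AbsolutelyContinuousOnInterval E 0 T := absolutelyContinuous_energy M hacq h.ac_D
  -- The integrating factor exp(3bt/4) leaves (b/14)B² exp(bt/4), with primitive (2/7)B² exp(bt/4).
  -- As 2/7 < 2/3, the initial value dominates and E(T) ≤ (2/3)B² exp(-bT/2).
  have key := sub_le_sub_of_ae_deriv_le (f := fun t => Real.exp (3 * b / 4 * t) * E t)
    (F := fun t => 2 / 7 * B ^ 2 * Real.exp (b / 4 * t))
    (F' := fun t => b / 14 * B ^ 2 * Real.exp (b / 4 * t)) hT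
    ((absolutelyContinuous_exp (3 * b / 4) 0 T).fun_mul hacE) (fun t => by
      have h1 : HasDerivAt (fun t : ℝ => b / 4 * t) (b / 4) t := by
        simpa using (hasDerivAt_id t).const_mul (b / 4)
      refine (h1.exp.const_mul (2 / 7 * B ^ 2)).congr_deriv ?_
      ring) (by fun_prop) (by
      filter_upwards [h.ae_deriv] with t ht htI
      obtain ⟨s, hs, hv, hDd⟩ := ht htI
      obtain ⟨d, hd, hle⟩ := h.energy_deriv_le hm ha hk hksymm hlam hb hb2 hH hM hMA hM0 hMle hB
        hR hσ hσ' hD hq htI hs hv hDd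
      have h1 : HasDerivAt (fun t : ℝ => 3 * b / 4 * t) (3 * b / 4) t := by
        simpa using (hasDerivAt_id t).const_mul (3 * b / 4)
      refine ⟨_, h1.exp.mul hd, ?_⟩
      have e4 : Real.exp (b / 4 * t)
          = Real.exp (3 * b / 4 * t) * Real.exp (-(b / 2) * t) := by
        rw [← Real.exp_add]
        ring_nf
      rw [e4]
      have := mul_le_mul_of_nonneg_left hle (Real.exp_pos (3 * b / 4 * t)).le
      linarith)
  simp only [mul_zero, Real.exp_zero, one_mul, mul_one] at key
  have hle : ∑ i, D i T ^ 2 ≤ E T := by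
    have := hM0 fun i => q i T
    simp only [hE, hDD]
    linarith
  have h1 : 1 ≤ Real.exp (b / 4 * T) := Real.one_le_exp (by positivity)
  have h2 : Real.exp (3 * b / 4 * T) * E T ≤ 2 / 3 * B ^ 2 * Real.exp (b / 4 * T) := by
    have hB2 : 0 < B ^ 2 := by positivity
    nlinarith
  have h3 : Real.exp (b / 4 * T) = Real.exp (3 * b / 4 * T) * Real.exp (-(b / 2) * T) := by
    rw [← Real.exp_add]
    ring_nf
  have h4 : E T ≤ 2 / 3 * (B ^ 2 * Real.exp (-(b / 2) * T)) := by
    rw [h3] at h2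
    refine le_of_mul_le_mul_left ?_ (Real.exp_pos (3 * b / 4 * T))
    linarith
  have h5 : 0 < B ^ 2 * Real.exp (-(b / 2) * T) := by positivity
  linarith

end Bootstrap

/-! ### Decay of the loss for a good initialization -/

theorem ntk_apply_of_abs_eq_one (x : Fin n → EuclideanSpace ℝ (Fin p)) {a : Fin m → ℝ}
    (ha : ∀ r, |a r| = 1) (W : Weights m p) (i j : Fin n) :
    ntk x a W i j = 1 / (m : ℝ) * ∑ r, reluDeriv (inner ℝ (W r) (x i)) *
      reluDeriv (inner ℝ (W r) (x j)) * inner ℝ (x i) (x j) := by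
  unfold ntk netGrad
  rw [of_apply, Finset.mul_sum]
  refine Finset.sum_congr rfl fun r _ => ?_
  rw [real_inner_smul_left, real_inner_smul_right]
  have har : a r * a r = 1 := by rw [← abs_mul_abs_self, ha r, one_mul]
  have hm : 1 / √(m : ℝ) * (1 / √(m : ℝ)) = 1 / (m : ℝ) := by
    rw [div_mul_div_comm, one_mul, Real.mul_self_sqrt (Nat.cast_nonneg m)]
  rw [← hm]
  linear_combination (1 / √(m : ℝ) * (1 / √(m : ℝ)) * reluDeriv (inner ℝ (W r) (x i)) *
      reluDeriv (inner ℝ (W r) (x j)) * inner ℝ (x i) (x j)) * har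

/-- Exponential decay of the residual in the lazy regime. -/
theorem IsHBFlow.sum_err_sq_le {x : Fin n → EuclideanSpace ℝ (Fin p)} {y : Fin n → ℝ}
    {a : Fin m → ℝ} {lam : ℝ} {W₀ : Weights m p} {W : ℝ → Weights m p}
    (hflow : IsHBFlow x y a √(2 * lam) W₀ W) (hm : 0 < m) (hx : ∀ i, ‖x i‖ = 1)
    (ha : ∀ r, |a r| = 1) (hlam : 0 < lam)
    (hpos : ∀ w, 7 / 8 * lam * (w ⬝ᵥ w) ≤ w ⬝ᵥ ntk x a W₀ *ᵥ w) {R σ B : ℝ} (hB : 0 ≤ B)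
    (hR : 8 / (3 * lam) * (√(n : ℝ) * B) ≤ R * √(m : ℝ))
    (hσ : ∑ i, ∑ r, (if |inner ℝ (W₀ r) (x i)| ≤ R then (1 : ℝ) else 0) ≤ σ * m)
    (hσ' : n * σ ^ 2 ≤ lam ^ 2 / 256) (h0 : 7 / 2 * ∑ i, err x y a W₀ i ^ 2 < B ^ 2)
    {t : ℝ} (ht : 0 ≤ t) :
    ∑ i, err x y a (W t) i ^ 2
      ≤ 7 / 2 * (∑ i, err x y a W₀ i ^ 2) * Real.exp (-√(lam / 2) * t) := by
  set b := √(2 * lam) with hbdef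
  have hb : 0 < b := Real.sqrt_pos.2 (by positivity)
  have hb2 : b ^ 2 = 2 * lam := Real.sq_sqrt (by positivity)
  have hbh : √(lam / 2) = b / 2 := by
    rw [hbdef, show 2 * lam = 2 ^ 2 * (lam / 2) by ring, Real.sqrt_mul (by norm_num),
      Real.sqrt_sq (by norm_num)]
    ring
  have hk : ∀ i j, |(inner ℝ (x i) (x j) : ℝ)| ≤ 1 := fun i j => by
    simpa [hx] using abs_real_inner_le_norm (x i) (x j)
  have hW0 : W 0 = W₀ := hflow.1
  obtain ⟨V, hV⟩ := hflow.isScalarFlow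
  set Φ : ℝ → ℝ := fun t => (∑ i, err x y a (W t) i ^ 2) * Real.exp (b / 2 * t) with hΦ
  have hΦc : ContinuousOn Φ (Ici 0) := by
    obtain ⟨-, V', G, -, hWd, -⟩ := hflow
    have hWc : ContinuousOn W (Ici 0) := fun t ht => (hWd t ht).continuousWithinAt
    refine ContinuousOn.mul (continuousOn_finsetSum _ fun i _ => ?_) (by fun_prop)
    exact ((continuous_err x y a i).comp_continuousOn hWc).pow 2
  have hexp : ∀ s : ℝ, Real.exp (b / 2 * s) * Real.exp (-(b / 2) * s) = 1 := fun s => by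
    rw [← Real.exp_add, neg_mul, add_neg_cancel, Real.exp_zero]
  have hΦ0 : Φ 0 = ∑ i, err x y a W₀ i ^ 2 := by simp [hΦ, hW0]
  have hS0 : 0 ≤ ∑ i, err x y a W₀ i ^ 2 := Finset.sum_nonneg fun i _ => sq_nonneg _
  -- The bootstrap runs at every level c above (7/2)|Δ(0)|², not only at B², so letting c decrease
  -- gives the sharp prefactor. Strictness keeps c positive even when Δ(0) = 0.
  have main : ∀ c, 7 / 2 * ∑ i, err x y a W₀ i ^ 2 < c → c ≤ B ^ 2 → Φ t < c := by
    intro c hc hcB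
    have hcpos : 0 < c := by linarith
    have hsq : √c ^ 2 = c := Real.sq_sqrt hcpos.le
    refine lt_of_bootstrap hΦc (by rw [hΦ0]; linarith) (fun T hT hle => ?_) ht
    have hstep := (hV T hT).bootstrap_step (B := √c) (R := R) (σ := σ) (H := ntk x a W₀) hT hm ha
      hk (fun i j => real_inner_comm _ _) hlam hb hb2
      (fun i j => by simp only [hW0]; exact ntk_apply_of_abs_eq_one x ha W₀ i j) hpos
      (Real.sqrt_pos.2 hcpos) (le_trans (by
        have : √c ≤ B := Real.sqrt_le_iff.2 ⟨hB, hcB⟩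
        gcongr) hR) (by simpa only [hW0] using hσ) hσ'
      (by simpa only [hW0, hsq] using hc.le) (fun s hs => by
        have := mul_le_mul_of_nonneg_right (hle s hs) (Real.exp_pos (-(b / 2) * s)).le
        simp only [hΦ] at this
        rwa [mul_assoc, hexp, mul_one, ← hsq] at this)
    rw [hsq] at hstep
    have := mul_lt_mul_of_pos_left hstep (Real.exp_pos (b / 2 * T))
    rw [mul_left_comm, hexp, mul_one] at this
    simpa only [hΦ, mul_comm] using this
  have hfin : Φ t ≤ 7 / 2 * ∑ i, err x y a W₀ i ^ 2 := by
    by_contra hcon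
    rw [not_le] at hcon
    have := main (min (Φ t) (B ^ 2)) (lt_min hcon h0) (min_le_right _ _)
    exact absurd (this.trans_le (min_le_left _ _)) (lt_irrefl _)
  have := mul_le_mul_of_nonneg_right hfin (Real.exp_pos (-(b / 2) * t)).le
  simp only [hΦ] at this
  rw [mul_assoc _ (Real.exp _) (Real.exp _), hexp, mul_one] at this
  rwa [hbh]

/-- Coercivity at time 0 trades |Δ(0)|² for Δ·HΔ at the cost 8/(7λ), and (7/2)·(8/7) = 4. -/
theorem IsHBFlow.loss_le {x : Fin n → EuclideanSpace ℝ (Fin p)} {y : Fin n → ℝ}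
    {a : Fin m → ℝ} {lam : ℝ} {W₀ : Weights m p} {W : ℝ → Weights m p}
    (hflow : IsHBFlow x y a √(2 * lam) W₀ W) (hm : 0 < m) (hx : ∀ i, ‖x i‖ = 1)
    (ha : ∀ r, |a r| = 1) (hlam : 0 < lam)
    (hpos : ∀ w, 7 / 8 * lam * (w ⬝ᵥ w) ≤ w ⬝ᵥ ntk x a W₀ *ᵥ w) {R σ B : ℝ} (hB : 0 ≤ B)
    (hR : 8 / (3 * lam) * (√(n : ℝ) * B) ≤ R * √(m : ℝ))
    (hσ : ∑ i, ∑ r, (if |inner ℝ (W₀ r) (x i)| ≤ R then (1 : ℝ) else 0) ≤ σ * m)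
    (hσ' : n * σ ^ 2 ≤ lam ^ 2 / 256) (h0 : 7 / 2 * ∑ i, err x y a W₀ i ^ 2 < B ^ 2)
    {t : ℝ} (ht : 0 ≤ t) :
    loss x y a (W t) ≤ 4 / lam * Real.exp (-√(lam / 2) * t) * pseudoLoss x y a W₀ := by
  have h1 := hflow.sum_err_sq_le hm hx ha hlam hpos hB hR hσ hσ' h0 ht
  have h2 := hpos (err x y a W₀)
  have h3 : err x y a W₀ ⬝ᵥ err x y a W₀ = ∑ i, err x y a W₀ i ^ 2 :=
    Finset.sum_congr rfl fun i _ => (sq _).symm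
  rw [h3] at h2
  unfold loss pseudoLoss
  set e := Real.exp (-√(lam / 2) * t)
  have he : 0 < e := Real.exp_pos _
  set S := ∑ i, err x y a W₀ i ^ 2
  set P := err x y a W₀ ⬝ᵥ ntk x a W₀ *ᵥ err x y a W₀
  have h4 : 7 / 4 * S ≤ 2 / lam * P := by
    rw [div_mul_eq_mul_div 2 lam P, le_div_iff₀ hlam]
    linarith
  have h5 := mul_le_mul_of_nonneg_right h4 he.le
  calc 1 / 2 * ∑ i, err x y a (W t) i ^ 2 ≤ 1 / 2 * (7 / 2 * S * e) := by gcongr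
    _ = 7 / 4 * S * e := by ring
    _ ≤ 2 / lam * P * e := h5
    _ = 4 / lam * e * (1 / 2 * P) := by ring

/-! ### The limiting kernel -/

theorem limitNTK_isHermitian (x : Fin n → EuclideanSpace ℝ (Fin p)) :
    (limitNTK x).IsHermitian := by
  rw [IsHermitian, conjTranspose_eq_transpose_of_trivial]
  ext i j
  simp only [limitNTK, transpose_apply, of_apply]
  refine integral_congr_ae (Eventually.of_forall fun w => ?_)
  simp only [real_inner_comm (x i) (x j)]
  ring

/-- Rayleigh bound: `λ₀ |w|² ≤ wᵀ H^∞ w`. -/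
theorem lam0_mul_le (x : Fin n → EuclideanSpace ℝ (Fin p)) (w : Fin n → ℝ) :
    lam0 x * (w ⬝ᵥ w) ≤ w ⬝ᵥ limitNTK x *ᵥ w := by
  have hH := limitNTK_isHermitian x
  have hbdd : BddBelow (spectrum ℝ (limitNTK x)) := by
    rw [hH.spectrum_real_eq_range_eigenvalues]
    exact (finite_range _).bddBelow
  have hPS : (limitNTK x - algebraMap ℝ _ (lam0 x)).PosSemidef := by
    refine posSemidef_iff_isHermitian_and_spectrum_nonneg.2 ⟨hH.sub ?_, ?_⟩
    · rw [IsHermitian, conjTranspose_eq_transpose_of_trivial, algebraMap_eq_diagonal,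
        diagonal_transpose]
    · rw [← spectrum.sub_singleton_eq]
      rintro _ ⟨z, hz, _, rfl, rfl⟩
      have : lam0 x ≤ z := csInf_le hbdd hz
      simpa using this
  have := hPS.dotProduct_mulVec_nonneg w
  rw [star_trivial, sub_mulVec, dotProduct_sub, Algebra.algebraMap_eq_smul_one, smul_mulVec,
    one_mulVec, dotProduct_smul, smul_eq_mul] at this
  linarith

theorem pos_of_lam0_pos {x : Fin n → EuclideanSpace ℝ (Fin p)} (h : 0 < lam0 x) : 0 < n := by
  rcases Nat.eq_zero_or_pos n with rfl | hn
  -- For an empty data set the spectrum is empty, and `sInf ∅ = 0`.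
  · have : lam0 x = 0 := by
      rw [lam0, spectrum.of_subsingleton, Real.sInf_empty]
    exact absurd h (by rw [this]; exact lt_irrefl 0)
  · exact hn

theorem measurable_reluDeriv : Measurable reluDeriv := by
  unfold reluDeriv
  exact Measurable.ite measurableSet_Ici measurable_const measurable_const

theorem abs_reluDeriv_le (z : ℝ) : |reluDeriv z| ≤ 1 := by
  obtain ⟨h0, h1⟩ := reluDeriv_mem_Icc z
  rwa [abs_of_nonneg h0]

/-- The integrand of the limiting kernel. -/
def kernelFun (x : Fin n → EuclideanSpace ℝ (Fin p)) (i j : Fin n)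
    (w : EuclideanSpace ℝ (Fin p)) : ℝ :=
  inner ℝ (x i) (x j) * (reluDeriv (inner ℝ w (x i)) * reluDeriv (inner ℝ w (x j)))

theorem measurable_kernelFun (x : Fin n → EuclideanSpace ℝ (Fin p)) (i j : Fin n) :
    Measurable (kernelFun x i j) := by
  have := measurable_reluDeriv
  unfold kernelFun
  fun_prop

theorem abs_kernelFun_le {x : Fin n → EuclideanSpace ℝ (Fin p)} (hx : ∀ i, ‖x i‖ = 1)
    (i j : Fin n) (w : EuclideanSpace ℝ (Fin p)) : |kernelFun x i j w| ≤ 1 := by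
  unfold kernelFun
  rw [abs_mul, abs_mul]
  have h1 : |(inner ℝ (x i) (x j) : ℝ)| ≤ 1 := by
    simpa [hx] using abs_real_inner_le_norm (x i) (x j)
  exact mul_le_one₀ h1 (by positivity)
    (mul_le_one₀ (abs_reluDeriv_le _) (abs_nonneg _) (abs_reluDeriv_le _))

/-- Testing with a basis vector bounds λ₀ by a diagonal entry of H^∞. This lets lower powers of 1/λ₀
be absorbed in the width condition. -/
theorem lam0_le_one {x : Fin n → EuclideanSpace ℝ (Fin p)} (hx : ∀ i, ‖x i‖ = 1) (hn : 0 < n) :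
    lam0 x ≤ 1 := by
  have h := lam0_mul_le x (Pi.single ⟨0, hn⟩ 1)
  simp only [dotProduct_single, Pi.single_eq_same, mul_one, mulVec_single_one,
    single_dotProduct, one_mul] at h
  refine h.trans ?_
  change ∫ w, kernelFun x ⟨0, hn⟩ ⟨0, hn⟩ w ∂_ ≤ 1
  refine (le_abs_self _).trans ?_
  have := norm_integral_le_of_norm_le_const (μ := stdGaussian (EuclideanSpace ℝ (Fin p)))
    (f := kernelFun x ⟨0, hn⟩ ⟨0, hn⟩) (C := 1) (Eventually.of_forall (abs_kernelFun_le hx ⟨0, hn⟩ ⟨0, hn⟩))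
  simpa using this

/-- A matrix that is close to `H` in Frobenius norm is almost as coercive as `H`. -/
theorem coercive_of_frobenius {H H' : Matrix (Fin n) (Fin n) ℝ} {lam ε : ℝ} (hε : 0 ≤ ε)
    (hH : ∀ w, lam * (w ⬝ᵥ w) ≤ w ⬝ᵥ H *ᵥ w)
    (hd : ∑ i, ∑ j, (H' i j - H i j) ^ 2 ≤ ε ^ 2) (w : Fin n → ℝ) :
    (lam - ε) * (w ⬝ᵥ w) ≤ w ⬝ᵥ H' *ᵥ w := by
  have h1 : w ⬝ᵥ H' *ᵥ w - w ⬝ᵥ H *ᵥ w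
      = ∑ ij : Fin n × Fin n, (w ij.1 * w ij.2) * (H' ij.1 ij.2 - H ij.1 ij.2) := by
    rw [← dotProduct_sub, ← sub_mulVec, Fintype.sum_prod_type]
    simp only [dotProduct, mulVec, Finset.mul_sum]
    refine Finset.sum_congr rfl fun i _ => Finset.sum_congr rfl fun j _ => ?_
    rw [Matrix.sub_apply]
    ring
  have h2 : ∑ ij : Fin n × Fin n, (w ij.1 * w ij.2) ^ 2 = (w ⬝ᵥ w) ^ 2 := by
    rw [Fintype.sum_prod_type, sq, dotProduct, Finset.sum_mul_sum]
    exact Finset.sum_congr rfl fun i _ => Finset.sum_congr rfl fun j _ => by ring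
  have h3 : ∑ ij : Fin n × Fin n, (H' ij.1 ij.2 - H ij.1 ij.2) ^ 2 ≤ ε ^ 2 := by
    rw [Fintype.sum_prod_type]
    exact hd
  -- Cauchy–Schwarz between wwᵀ, of Frobenius norm |w|², and H' - H.
  have h4 := Finset.sum_mul_sq_le_sq_mul_sq Finset.univ
    (fun ij : Fin n × Fin n => w ij.1 * w ij.2) (fun ij => H' ij.1 ij.2 - H ij.1 ij.2)
  rw [← h1, h2] at h4
  have hw : 0 ≤ w ⬝ᵥ w := dotProduct_self_nonneg w
  have h5 : (w ⬝ᵥ H' *ᵥ w - w ⬝ᵥ H *ᵥ w) ^ 2 ≤ (ε * (w ⬝ᵥ w)) ^ 2 := by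
    refine h4.trans ?_
    rw [mul_pow, mul_comm (ε ^ 2)]
    gcongr
  have h6 := (abs_le_of_sq_le_sq' h5 (by positivity)).1
  linarith [hH w]

/-! ### Gaussian and sign initialization -/

theorem map_inner_stdGaussian {x : EuclideanSpace ℝ (Fin p)} (hx : ‖x‖ = 1) :
    (stdGaussian (EuclideanSpace ℝ (Fin p))).map (fun w => inner ℝ w x) = gaussianReal 0 1 := by
  have h := IsGaussian.map_eq_gaussianReal (μ := stdGaussian (EuclideanSpace ℝ (Fin p)))
    (innerSL ℝ x)
  rw [variance_dual_stdGaussian, integral_strongDual_stdGaussian, innerSL_apply_norm, hx] at h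
  have e : (fun w => inner ℝ w x) = ⇑(innerSL ℝ x) := by
    ext w
    simp [real_inner_comm]
  rw [e, h]
  simp

theorem lintegral_inner_sq_stdGaussian {x : EuclideanSpace ℝ (Fin p)} (hx : ‖x‖ = 1) :
    ∫⁻ w, ENNReal.ofReal (inner ℝ w x ^ 2) ∂(stdGaussian (EuclideanSpace ℝ (Fin p))) = 1 := by
  have h1 : ∫⁻ z : ℝ, ENNReal.ofReal (z ^ 2) ∂(gaussianReal 0 1) = 1 := by
    rw [← ofReal_integral_eq_lintegral_ofReal]
    · have := variance_id_gaussianReal (μ := 0) (v := 1)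
      rw [variance_eq_integral (by fun_prop)] at this
      simp only [id, integral_id_gaussianReal, sub_zero, NNReal.coe_one] at this
      rw [this, ENNReal.ofReal_one]
    · exact (memLp_id_gaussianReal 2).integrable_sq
    · exact Eventually.of_forall fun z => sq_nonneg z
  rw [← map_inner_stdGaussian hx, lintegral_map (by fun_prop) (by fun_prop)] at h1
  exact h1

/-- The projection is standard normal; its density is at most 1/√(2π) ≤ 1/2, and the interval has
length 2R. -/
theorem stdGaussian_abs_inner_le {x : EuclideanSpace ℝ (Fin p)} (hx : ‖x‖ = 1) {R : ℝ} :
    stdGaussian (EuclideanSpace ℝ (Fin p)) {w | |inner ℝ w x| ≤ R} ≤ ENNReal.ofReal R := by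
  have e : {w : EuclideanSpace ℝ (Fin p) | |inner ℝ w x| ≤ R}
      = (fun w => inner ℝ w x) ⁻¹' Icc (-R) R := by
    ext w
    simp [abs_le]
  rw [e, ← Measure.map_apply (by fun_prop) measurableSet_Icc, map_inner_stdGaussian hx,
    gaussianReal_apply _ one_ne_zero]
  have hpdf : ∀ z : ℝ, gaussianPDF 0 1 z ≤ ENNReal.ofReal (1 / 2) := by
    intro z
    rw [gaussianPDF]
    refine ENNReal.ofReal_le_ofReal ?_
    rw [gaussianPDFReal]
    have h1 : Real.exp (-(z - 0) ^ 2 / (2 * ((1 : NNReal) : ℝ))) ≤ 1 := by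
      refine Real.exp_le_one_iff.2 ?_
      have := sq_nonneg (z - 0)
      simp only [NNReal.coe_one]
      linarith
    have h2 : (√(2 * Real.pi * ((1 : NNReal) : ℝ)))⁻¹ ≤ 1 / 2 := by
      rw [inv_le_comm₀ (by simp [Real.pi_pos]) (by norm_num)]
      refine Real.le_sqrt_of_sq_le ?_
      simp only [NNReal.coe_one]
      linarith [Real.pi_gt_three]
    calc _ ≤ (√(2 * Real.pi * ((1 : NNReal) : ℝ)))⁻¹ * 1 :=
          mul_le_mul_of_nonneg_left h1 (by positivity)
      _ ≤ 1 / 2 := by rwa [mul_one]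
  calc ∫⁻ z in Icc (-R) R, gaussianPDF 0 1 z
      ≤ ∫⁻ _ in Icc (-R) R, ENNReal.ofReal (1 / 2) := lintegral_mono fun z => hpdf z
    _ = ENNReal.ofReal R := by
        rw [setLIntegral_const, Real.volume_Icc, ← ENNReal.ofReal_mul (by norm_num)]
        congr 1
        ring

/-- The uniform distribution on `{-1, 1}`. -/
abbrev signLaw : Measure ℝ :=
  (2⁻¹ : ENNReal) • Measure.dirac (1 : ℝ) + (2⁻¹ : ENNReal) • Measure.dirac (-1 : ℝ)

instance isProbabilityMeasure_signLaw : IsProbabilityMeasure signLaw :=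
  ⟨by simp [ENNReal.inv_two_add_inv_two]⟩

instance isProbabilityMeasure_initLaw : IsProbabilityMeasure (initLaw m p) := by
  unfold initLaw
  have := isProbabilityMeasure_signLaw
  infer_instance

/-- Second moment of a centred sum of independent random variables. -/
theorem lintegral_sum_sub_sq_pi {ι Ω : Type*} [Fintype ι] [MeasurableSpace Ω] {μ : Measure Ω}
    [IsProbabilityMeasure μ] {X : ι → Ω → ℝ} (hX : ∀ r, MemLp (X r) 2 μ) :
    ∫⁻ ω : ι → Ω, ENNReal.ofReal ((∑ r, X r (ω r) - ∑ r, ∫ z, X r z ∂μ) ^ 2)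
        ∂(Measure.pi fun _ => μ) = ENNReal.ofReal (∑ r, Var[X r; μ]) := by
  have hL : ∀ r, MemLp (fun ω : ι → Ω => X r (ω r)) 2 (Measure.pi fun _ => μ) := fun r =>
    (hX r).comp_measurePreserving (measurePreserving_eval (fun _ => μ) r)
  have hsum : MemLp (∑ r, fun ω : ι → Ω => X r (ω r)) 2 (Measure.pi fun _ => μ) :=
    memLp_finsetSum' _ fun r _ => hL r
  rw [← variance_sum_pi hX, ofReal_variance hsum, evariance_eq_lintegral_ofReal]
  have e : ∫ ω, (∑ r, fun ω : ι → Ω => X r (ω r)) ω ∂(Measure.pi fun _ => μ)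
      = ∑ r, ∫ z, X r z ∂μ := by
    simp only [Finset.sum_apply]
    rw [integral_finsetSum _ fun r _ => (hL r).integrable one_le_two]
    exact Finset.sum_congr rfl fun r _ =>
      integral_comp_eval (μ := fun _ => μ) (hX r).aestronglyMeasurable
  rw [e]
  simp only [Finset.sum_apply]

theorem lintegral_comp_eval_pi {ι Ω : Type*} [Fintype ι] [MeasurableSpace Ω] {μ : Measure Ω}
    [IsProbabilityMeasure μ] {f : Ω → ENNReal} (hf : Measurable f) (r : ι) :
    ∫⁻ ω : ι → Ω, f (ω r) ∂(Measure.pi fun _ => μ) = ∫⁻ z, f z ∂μ :=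
  (measurePreserving_eval (fun _ => μ) r).lintegral_comp hf

theorem lintegral_fst_initLaw {f : Weights m p → ENNReal} (hf : Measurable f) :
    ∫⁻ ω, f ω.1 ∂(initLaw m p)
      = ∫⁻ W, f W ∂(Measure.pi fun _ : Fin m => stdGaussian (EuclideanSpace ℝ (Fin p))) := by
  have := isProbabilityMeasure_signLaw
  exact (measurePreserving_fst (μ := Measure.pi fun _ : Fin m =>
    stdGaussian (EuclideanSpace ℝ (Fin p))) (ν := Measure.pi fun _ : Fin m => signLaw)).lintegral_comp
    hf

/-- The empirical kernel as a function of the weights. -/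
def empKernel (x : Fin n → EuclideanSpace ℝ (Fin p)) (W : Weights m p) (i j : Fin n) : ℝ :=
  ∑ r, 1 / (m : ℝ) * kernelFun x i j (W r)

theorem measurable_empKernel (x : Fin n → EuclideanSpace ℝ (Fin p)) (i j : Fin n) :
    Measurable fun W : Weights m p => empKernel x W i j := by
  unfold empKernel
  exact Finset.measurable_sum _ fun r _ =>
    ((measurable_kernelFun x i j).comp (measurable_pi_apply r)).const_mul _

theorem ntk_eq_empKernel (x : Fin n → EuclideanSpace ℝ (Fin p)) {a : Fin m → ℝ}
    (ha : ∀ r, |a r| = 1) (W : Weights m p) (i j : Fin n) :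
    ntk x a W i j = empKernel x W i j := by
  rw [ntk_apply_of_abs_eq_one x ha, empKernel, Finset.mul_sum]
  refine Finset.sum_congr rfl fun r _ => ?_
  rw [kernelFun]
  ring

/-- The entry is a mean of m independent variables with values in [-1, 1], each of variance at most
1. -/
theorem lintegral_empKernel_sub_sq_le {x : Fin n → EuclideanSpace ℝ (Fin p)}
    (hx : ∀ i, ‖x i‖ = 1) (hm : 0 < m) (i j : Fin n) :
    ∫⁻ ω, ENNReal.ofReal ((empKernel x ω.1 i j - limitNTK x i j) ^ 2) ∂(initLaw m p)
      ≤ ENNReal.ofReal (1 / m) := by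
  have hm' : (0 : ℝ) < m := by exact_mod_cast hm
  set μ := stdGaussian (EuclideanSpace ℝ (Fin p)) with hμ
  have hb : ∀ᵐ w ∂μ, kernelFun x i j w ∈ Icc (-1) 1 :=
    Eventually.of_forall fun w => abs_le.1 (abs_kernelFun_le hx i j w)
  have hL : MemLp (kernelFun x i j) 2 μ :=
    memLp_of_bounded hb (measurable_kernelFun x i j).aestronglyMeasurable 2
  have hmeas := measurable_empKernel (m := m) x i j
  rw [lintegral_fst_initLaw
    (f := fun W => ENNReal.ofReal ((empKernel x W i j - limitNTK x i j) ^ 2)) (by fun_prop)]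
  have h1 := lintegral_sum_sub_sq_pi (ι := Fin m) (μ := μ)
    (X := fun _ w => 1 / (m : ℝ) * kernelFun x i j w) (fun r => hL.const_mul _)
  have e : ∑ _r : Fin m, ∫ z, 1 / (m : ℝ) * kernelFun x i j z ∂μ = limitNTK x i j := by
    rw [integral_const_mul, Finset.sum_const, Finset.card_univ, Fintype.card_fin, nsmul_eq_mul,
      ← mul_assoc, mul_one_div_cancel hm'.ne', one_mul]
    rfl
  rw [e] at h1
  simp only [empKernel]
  rw [h1]
  refine ENNReal.ofReal_le_ofReal ?_
  have hv := variance_le_sq_of_bounded hb (measurable_kernelFun x i j).aemeasurable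
  rw [variance_const_mul, Finset.sum_const, Finset.card_univ, Fintype.card_fin, nsmul_eq_mul]
  norm_num at hv
  calc (m : ℝ) * ((1 / (m : ℝ)) ^ 2 * Var[kernelFun x i j; μ])
      ≤ (m : ℝ) * ((1 / (m : ℝ)) ^ 2 * 1) := by gcongr
    _ = 1 / (m : ℝ) := by field_simp

theorem integral_id_signLaw : ∫ z, z ∂signLaw = 0 := by
  rw [integral_add_measure, integral_smul_measure, integral_smul_measure, integral_dirac,
    integral_dirac]
  · simp
  · exact (integrable_dirac (by simp)).smul_measure (by simp)
  · exact (integrable_dirac (by simp)).smul_measure (by simp)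

theorem ae_abs_eq_one_signLaw : ∀ᵐ z ∂signLaw, |z| = 1 := by
  rw [ae_add_measure_iff]
  constructor <;>
  · refine Measure.ae_smul_measure ?_ _
    rw [ae_dirac_eq]
    simp

theorem ae_abs_eq_one_initLaw : ∀ᵐ ω ∂(initLaw m p), ∀ r, |ω.2 r| = 1 := by
  have := isProbabilityMeasure_signLaw
  have h : ∀ᵐ a ∂(Measure.pi fun _ : Fin m => signLaw), ∀ r, |a r| = 1 :=
    ae_all_iff.2 fun r => (measurePreserving_eval (fun _ : Fin m => signLaw)
      r).quasiMeasurePreserving.ae ae_abs_eq_one_signLaw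
  exact (measurePreserving_snd (μ := Measure.pi fun _ : Fin m =>
    stdGaussian (EuclideanSpace ℝ (Fin p)))
    (ν := Measure.pi fun _ : Fin m => signLaw)).quasiMeasurePreserving.ae h

theorem measurable_net (z : EuclideanSpace ℝ (Fin p)) :
    Measurable fun ω : Weights m p × (Fin m → ℝ) => net ω.2 ω.1 z := by
  have := continuous_relu
  have : Continuous fun ω : Weights m p × (Fin m → ℝ) => net ω.2 ω.1 z := by
    unfold net
    fun_prop
  exact this.measurable

/-- Given the weights, the output is a sum with independent centred signs, so its second moment is
at most the mean of (w_r·z)², whose Gaussian expectation is 1. -/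
theorem lintegral_net_sq_le {z : EuclideanSpace ℝ (Fin p)} (hz : ‖z‖ = 1) :
    ∫⁻ ω, ENNReal.ofReal (net ω.2 ω.1 z ^ 2) ∂(initLaw m p) ≤ 1 := by
  have := isProbabilityMeasure_signLaw
  have hb : ∀ᵐ z ∂signLaw, z ∈ Icc (-1 : ℝ) 1 := by
    filter_upwards [ae_abs_eq_one_signLaw] with z hz using abs_le.1 hz.le
  have hL : MemLp (fun z : ℝ => z) 2 signLaw := memLp_of_bounded hb (by fun_prop) 2
  have hvar : Var[fun z : ℝ => z; signLaw] ≤ 1 := by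
    have := variance_le_sq_of_bounded hb (X := fun z : ℝ => z) (by fun_prop)
    norm_num at this
    exact this
  have hm := measurable_net (m := m) z
  rw [initLaw, lintegral_prod _ (hm.pow_const 2).ennreal_ofReal.aemeasurable]
  have inner_le : ∀ W : Weights m p,
      ∫⁻ a, ENNReal.ofReal (net a W z ^ 2) ∂(Measure.pi fun _ : Fin m => signLaw)
        ≤ ∑ r, ENNReal.ofReal (1 / (m : ℝ)) * ENNReal.ofReal (inner ℝ (W r) z ^ 2) := by
    intro W
    have h1 := lintegral_sum_sub_sq_pi (ι := Fin m) (μ := signLaw)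
      (X := fun r w => (1 / √(m : ℝ) * relu (inner ℝ (W r) z)) * w) (fun r => hL.const_mul _)
    have e0 : ∑ r, ∫ t, (1 / √(m : ℝ) * relu (inner ℝ (W r) z)) * t ∂signLaw = 0 :=
      Finset.sum_eq_zero fun r _ => by rw [integral_const_mul, integral_id_signLaw, mul_zero]
    have ev : ∀ r, Var[fun t => (1 / √(m : ℝ) * relu (inner ℝ (W r) z)) * t; signLaw]
        = (1 / √(m : ℝ) * relu (inner ℝ (W r) z)) ^ 2 * Var[fun t : ℝ => t; signLaw] := fun r =>
      variance_const_mul _ (fun t : ℝ => t) signLaw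
    rw [e0, Finset.sum_congr rfl fun r _ => ev r] at h1
    simp only [sub_zero] at h1
    have e : ∀ a : Fin m → ℝ, net a W z = ∑ r, (1 / √(m : ℝ) * relu (inner ℝ (W r) z)) * a r := by
      intro a
      rw [net, Finset.mul_sum]
      exact Finset.sum_congr rfl fun r _ => by ring
    simp only [e]
    rw [h1, ENNReal.ofReal_sum_of_nonneg fun r _ => mul_nonneg (sq_nonneg _) (variance_nonneg _ _)]
    refine Finset.sum_le_sum fun r _ => ?_
    rw [← ENNReal.ofReal_mul (by positivity)]
    refine ENNReal.ofReal_le_ofReal ?_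
    have hr : relu (inner ℝ (W r) z) ^ 2 ≤ inner ℝ (W r) z ^ 2 := by
      rw [← sq_abs (inner ℝ (W r) z)]
      refine pow_le_pow_left₀ (relu_nonneg _) ?_ 2
      exact max_le (le_abs_self _) (abs_nonneg _)
    calc (1 / √(m : ℝ) * relu (inner ℝ (W r) z)) ^ 2 * Var[fun z : ℝ => z; signLaw]
        ≤ (1 / √(m : ℝ) * relu (inner ℝ (W r) z)) ^ 2 * 1 := by gcongr
      _ = 1 / (m : ℝ) * relu (inner ℝ (W r) z) ^ 2 := by
        rw [mul_one, mul_pow, div_pow, one_pow, Real.sq_sqrt (Nat.cast_nonneg m)]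
      _ ≤ 1 / (m : ℝ) * inner ℝ (W r) z ^ 2 := by gcongr
  refine (lintegral_mono inner_le).trans ?_
  rw [lintegral_finsetSum _ fun r _ => by fun_prop]
  have h2 : ∀ r : Fin m, ∫⁻ W : Weights m p, ENNReal.ofReal (1 / (m : ℝ)) *
      ENNReal.ofReal (inner ℝ (W r) z ^ 2)
        ∂(Measure.pi fun _ : Fin m => stdGaussian (EuclideanSpace ℝ (Fin p)))
      = ENNReal.ofReal (1 / (m : ℝ)) := by
    intro r
    rw [lintegral_const_mul _ (by fun_prop), lintegral_comp_eval_pi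
      (f := fun w : EuclideanSpace ℝ (Fin p) => ENNReal.ofReal (inner ℝ w z ^ 2)) (by fun_prop) r,
      lintegral_inner_sq_stdGaussian hz, mul_one]
  simp only [h2]
  rw [← ENNReal.ofReal_sum_of_nonneg fun r _ => by positivity, ← ENNReal.ofReal_one]
  refine ENNReal.ofReal_le_ofReal ?_
  rw [Finset.sum_const, Finset.card_univ, Fintype.card_fin, nsmul_eq_mul]
  rw [mul_one_div]
  -- The inequality also covers m = 0, where the quotient is 0.
  exact div_self_le_one _

theorem lintegral_sum_err_sq_le {x : Fin n → EuclideanSpace ℝ (Fin p)} {y : Fin n → ℝ} {C : ℝ}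
    (hx : ∀ i, ‖x i‖ = 1) (hy : ∀ i, |y i| < C) :
    ∫⁻ ω, ENNReal.ofReal (∑ i, err x y ω.2 ω.1 i ^ 2) ∂(initLaw m p)
      ≤ ENNReal.ofReal (n * (2 + 2 * C ^ 2)) := by
  have hmeas : ∀ i, Measurable fun ω : Weights m p × (Fin m → ℝ) => err x y ω.2 ω.1 i :=
    fun i => (measurable_net (x i)).sub_const (y i)
  have h1 : ∀ i, ∫⁻ ω, ENNReal.ofReal (err x y ω.2 ω.1 i ^ 2) ∂(initLaw m p)
      ≤ ENNReal.ofReal (2 + 2 * C ^ 2) := by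
    intro i
    have hyi : y i ^ 2 ≤ C ^ 2 := by
      rw [← sq_abs]
      exact pow_le_pow_left₀ (abs_nonneg _) (hy i).le 2
    calc ∫⁻ ω, ENNReal.ofReal (err x y ω.2 ω.1 i ^ 2) ∂(initLaw m p)
        ≤ ∫⁻ ω, (ENNReal.ofReal 2 * ENNReal.ofReal (net ω.2 ω.1 (x i) ^ 2)
            + ENNReal.ofReal (2 * C ^ 2)) ∂(initLaw m p) := by
          refine lintegral_mono fun ω => ?_
          rw [← ENNReal.ofReal_mul (by norm_num), ← ENNReal.ofReal_add (by positivity)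
            (by positivity)]
          refine ENNReal.ofReal_le_ofReal ?_
          rw [err]
          nlinarith [sq_nonneg (net ω.2 ω.1 (x i) + y i)]
      _ = ENNReal.ofReal 2 * ∫⁻ ω, ENNReal.ofReal (net ω.2 ω.1 (x i) ^ 2) ∂(initLaw m p)
            + ENNReal.ofReal (2 * C ^ 2) := by
          have := measurable_net (m := m) (x i)
          rw [lintegral_add_right _ measurable_const, lintegral_const_mul _ (by fun_prop),
            lintegral_const, measure_univ, mul_one]
      _ ≤ ENNReal.ofReal 2 * 1 + ENNReal.ofReal (2 * C ^ 2) := by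
          gcongr
          exact lintegral_net_sq_le (hx i)
      _ = ENNReal.ofReal (2 + 2 * C ^ 2) := by
          rw [mul_one, ENNReal.ofReal_add (by norm_num) (by positivity)]
  have e : ∀ ω : Weights m p × (Fin m → ℝ), ENNReal.ofReal (∑ i, err x y ω.2 ω.1 i ^ 2)
      = ∑ i, ENNReal.ofReal (err x y ω.2 ω.1 i ^ 2) := fun ω =>
    ENNReal.ofReal_sum_of_nonneg fun i _ => sq_nonneg _
  simp only [e]
  rw [lintegral_finsetSum _ fun i _ => by have := hmeas i; fun_prop]
  refine (Finset.sum_le_sum fun i _ => h1 i).trans (le_of_eq ?_)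
  rw [Finset.sum_const, Finset.card_univ, Fintype.card_fin, nsmul_eq_mul,
    ENNReal.ofReal_mul (Nat.cast_nonneg n), ENNReal.ofReal_natCast]

theorem measurable_smallIndicator (z : EuclideanSpace ℝ (Fin p)) (R : ℝ) :
    Measurable fun w : EuclideanSpace ℝ (Fin p) => if |inner ℝ w z| ≤ R then (1 : ℝ) else 0 :=
  Measurable.ite (measurableSet_le (by fun_prop) measurable_const) measurable_const
    measurable_const

theorem lintegral_sum_small_le {x : Fin n → EuclideanSpace ℝ (Fin p)} (hx : ∀ i, ‖x i‖ = 1)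
    (R : ℝ) :
    ∫⁻ ω, ENNReal.ofReal (∑ i, ∑ r, if |inner ℝ (ω.1 r) (x i)| ≤ R then (1 : ℝ) else 0)
      ∂(initLaw m p) ≤ ENNReal.ofReal (n * (m * R)) := by
  have hmeas : ∀ i (r : Fin m), Measurable fun W : Weights m p =>
      ENNReal.ofReal (if |inner ℝ (W r) (x i)| ≤ R then (1 : ℝ) else 0) := fun i r =>
    ((measurable_smallIndicator (x i) R).comp (measurable_pi_apply r)).ennreal_ofReal
  have h01 : ∀ (W : Weights m p) i r,
      (0 : ℝ) ≤ if |inner ℝ (W r) (x i)| ≤ R then (1 : ℝ) else 0 := fun W i r => by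
    split_ifs <;> norm_num
  have h1 : ∀ i (r : Fin m), ∫⁻ W : Weights m p,
      ENNReal.ofReal (if |inner ℝ (W r) (x i)| ≤ R then (1 : ℝ) else 0)
        ∂(Measure.pi fun _ : Fin m => stdGaussian (EuclideanSpace ℝ (Fin p)))
      ≤ ENNReal.ofReal R := by
    intro i r
    rw [lintegral_comp_eval_pi (f := fun w : EuclideanSpace ℝ (Fin p) =>
      ENNReal.ofReal (if |inner ℝ w (x i)| ≤ R then (1 : ℝ) else 0))
      (measurable_smallIndicator (x i) R).ennreal_ofReal r]
    refine le_trans (le_of_eq ?_) (stdGaussian_abs_inner_le (hx i))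
    rw [← lintegral_indicator_one (measurableSet_le (by fun_prop) measurable_const)]
    refine lintegral_congr fun w => ?_
    by_cases h : |inner ℝ w (x i)| ≤ R <;> simp [h, indicator]
  have e : ∀ W : Weights m p,
      ENNReal.ofReal (∑ i, ∑ r, if |inner ℝ (W r) (x i)| ≤ R then (1 : ℝ) else 0)
      = ∑ i, ∑ r, ENNReal.ofReal (if |inner ℝ (W r) (x i)| ≤ R then (1 : ℝ) else 0) := by
    intro W
    rw [ENNReal.ofReal_sum_of_nonneg fun i _ => Finset.sum_nonneg fun r _ => h01 W i r]
    exact Finset.sum_congr rfl fun i _ => ENNReal.ofReal_sum_of_nonneg fun r _ => h01 W i r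
  simp only [e]
  rw [lintegral_fst_initLaw (f := fun W : Weights m p => ∑ i, ∑ r,
      ENNReal.ofReal (if |inner ℝ (W r) (x i)| ≤ R then (1 : ℝ) else 0))
      (Finset.measurable_sum _ fun i _ => Finset.measurable_sum _ fun r _ => hmeas i r),
    lintegral_finsetSum _ fun i _ => Finset.measurable_sum _ fun r _ => hmeas i r]
  have h2 : ∀ i, ∫⁻ W : Weights m p, ∑ r,
      ENNReal.ofReal (if |inner ℝ (W r) (x i)| ≤ R then (1 : ℝ) else 0)
        ∂(Measure.pi fun _ : Fin m => stdGaussian (EuclideanSpace ℝ (Fin p)))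
      ≤ ENNReal.ofReal (m * R) := by
    intro i
    rw [lintegral_finsetSum _ fun r _ => hmeas i r]
    refine (Finset.sum_le_sum fun r _ => h1 i r).trans (le_of_eq ?_)
    rw [Finset.sum_const, Finset.card_univ, Fintype.card_fin, nsmul_eq_mul,
      ENNReal.ofReal_mul (Nat.cast_nonneg m), ENNReal.ofReal_natCast]
  refine (Finset.sum_le_sum fun i _ => h2 i).trans (le_of_eq ?_)
  rw [Finset.sum_const, Finset.card_univ, Fintype.card_fin, nsmul_eq_mul,
    ENNReal.ofReal_mul (Nat.cast_nonneg n), ENNReal.ofReal_natCast]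

theorem lintegral_frobenius_le {x : Fin n → EuclideanSpace ℝ (Fin p)}
    (hx : ∀ i, ‖x i‖ = 1) (hm : 0 < m) :
    ∫⁻ ω, ENNReal.ofReal (∑ i, ∑ j, (empKernel x ω.1 i j - limitNTK x i j) ^ 2) ∂(initLaw m p)
      ≤ ENNReal.ofReal (n * (n * (1 / m))) := by
  have hmeas : ∀ i j, Measurable fun ω : Weights m p × (Fin m → ℝ) =>
      ENNReal.ofReal ((empKernel x ω.1 i j - limitNTK x i j) ^ 2) := fun i j =>
    ((((measurable_empKernel x i j).comp measurable_fst).sub_const _).pow_const 2).ennreal_ofReal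
  have e : ∀ ω : Weights m p × (Fin m → ℝ),
      ENNReal.ofReal (∑ i, ∑ j, (empKernel x ω.1 i j - limitNTK x i j) ^ 2)
      = ∑ i, ∑ j, ENNReal.ofReal ((empKernel x ω.1 i j - limitNTK x i j) ^ 2) := by
    intro ω
    rw [ENNReal.ofReal_sum_of_nonneg fun i _ => Finset.sum_nonneg fun j _ => sq_nonneg _]
    exact Finset.sum_congr rfl fun i _ => ENNReal.ofReal_sum_of_nonneg fun j _ => sq_nonneg _
  simp only [e]
  rw [lintegral_finsetSum _ fun i _ => Finset.measurable_sum _ fun j _ => hmeas i j]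
  have h2 : ∀ i, ∫⁻ ω, ∑ j, ENNReal.ofReal ((empKernel x ω.1 i j - limitNTK x i j) ^ 2)
      ∂(initLaw m p) ≤ ENNReal.ofReal (n * (1 / m)) := by
    intro i
    rw [lintegral_finsetSum _ fun j _ => hmeas i j]
    refine (Finset.sum_le_sum fun j _ => lintegral_empKernel_sub_sq_le hx hm i j).trans
      (le_of_eq ?_)
    rw [Finset.sum_const, Finset.card_univ, Fintype.card_fin, nsmul_eq_mul,
      ENNReal.ofReal_mul (Nat.cast_nonneg n), ENNReal.ofReal_natCast]
  refine (Finset.sum_le_sum fun i _ => h2 i).trans (le_of_eq ?_)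
  rw [Finset.sum_const, Finset.card_univ, Fintype.card_fin, nsmul_eq_mul,
    ENNReal.ofReal_mul (p := (n : ℝ)) (q := n * (1 / m)) (Nat.cast_nonneg n),
    ENNReal.ofReal_natCast]

/-! ### Good initializations and the width condition -/

/-- Markov's inequality. -/
theorem measure_le_of_lintegral_le {Ω : Type*} [MeasurableSpace Ω] {μ : Measure Ω} {f : Ω → ℝ}
    {c ε δ : ℝ} (hf : Measurable f) (h : ∫⁻ ω, ENNReal.ofReal (f ω) ∂μ ≤ ENNReal.ofReal c)
    (hε : 0 < ε) (hc : c ≤ ε * δ) : μ {ω | ε ≤ f ω} ≤ ENNReal.ofReal δ := by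
  have h1 := mul_meas_ge_le_lintegral (μ := μ) hf.ennreal_ofReal (ENNReal.ofReal ε)
  have h2 : ENNReal.ofReal ε * μ {ω | ε ≤ f ω} ≤ ENNReal.ofReal ε * ENNReal.ofReal δ := by
    rw [← ENNReal.ofReal_mul hε.le]
    refine le_trans ?_ (h1.trans (h.trans (ENNReal.ofReal_le_ofReal hc)))
    gcongr
    exact fun hω => ENNReal.ofReal_le_ofReal hω
  rwa [ENNReal.mul_le_mul_iff_right (by simpa using hε) ENNReal.ofReal_ne_top] at h2

/-- With high probability the initialization is in the lazy regime: the output signs are `±1`, the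
kernel is close to its limit, the residual is moderate and few neurons are near a kink. -/
theorem exists_good_initialization {x : Fin n → EuclideanSpace ℝ (Fin p)} {y : Fin n → ℝ}
    {C δ ε R : ℝ} (hx : ∀ i, ‖x i‖ = 1) (hy : ∀ i, |y i| < C) (hn : 0 < n) (hm : 0 < m)
    (hδ : 0 < δ) (hε : 0 < ε) (hR : 0 < R) (hmε : 3 * (n : ℝ) ^ 2 ≤ ε ^ 2 * δ * m) :
    ∃ S : Set (Weights m p × (Fin m → ℝ)), MeasurableSet S ∧
      ENNReal.ofReal (1 - δ) ≤ initLaw m p S ∧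
      ∀ ω ∈ S, (∀ r, |ω.2 r| = 1) ∧
        ∑ i, ∑ j, (ntk x ω.2 ω.1 i j - limitNTK x i j) ^ 2 ≤ ε ^ 2 ∧
        ∑ i, err x y ω.2 ω.1 i ^ 2 < 3 / δ * (n * (2 + 2 * C ^ 2)) ∧
        ∑ i, ∑ r, (if |inner ℝ (ω.1 r) (x i)| ≤ R then (1 : ℝ) else 0)
          ≤ 3 / δ * (n * (m * R)) := by
  have hn' : (0 : ℝ) < n := by exact_mod_cast hn
  have hm' : (0 : ℝ) < m := by exact_mod_cast hm
  set f₁ : Weights m p × (Fin m → ℝ) → ℝ := fun ω =>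
    ∑ i, ∑ j, (empKernel x ω.1 i j - limitNTK x i j) ^ 2 with hf₁
  set f₂ : Weights m p × (Fin m → ℝ) → ℝ := fun ω => ∑ i, err x y ω.2 ω.1 i ^ 2 with hf₂
  set f₃ : Weights m p × (Fin m → ℝ) → ℝ := fun ω =>
    ∑ i, ∑ r, (if |inner ℝ (ω.1 r) (x i)| ≤ R then (1 : ℝ) else 0) with hf₃
  have m₁ : Measurable f₁ := Finset.measurable_sum _ fun i _ => Finset.measurable_sum _ fun j _ =>
    ((((measurable_empKernel x i j).comp measurable_fst).sub_const _).pow_const 2)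
  have m₂ : Measurable f₂ := Finset.measurable_sum _ fun i _ =>
    ((measurable_net (x i)).sub_const (y i)).pow_const 2
  have m₃ : Measurable f₃ := Finset.measurable_sum _ fun i _ => Finset.measurable_sum _ fun r _ =>
    (measurable_smallIndicator (x i) R).comp ((measurable_pi_apply r).comp measurable_fst)
  set A : Set (Weights m p × (Fin m → ℝ)) := {ω | ∀ r, |ω.2 r| = 1} with hA
  have mA : MeasurableSet A := by
    have : A = ⋂ r, {ω | |ω.2 r| = 1} := by
      ext ω
      simp [hA]
    rw [this]
    exact MeasurableSet.iInter fun r => measurableSet_eq_fun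
      (((measurable_pi_apply r).comp measurable_snd).abs) measurable_const
  set B₁ := {ω | ε ^ 2 ≤ f₁ ω}
  set B₂ := {ω | 3 / δ * (n * (2 + 2 * C ^ 2)) ≤ f₂ ω}
  set B₃ := {ω | 3 / δ * (n * (m * R)) ≤ f₃ ω}
  have mB₁ : MeasurableSet B₁ := measurableSet_le measurable_const m₁
  have mB₂ : MeasurableSet B₂ := measurableSet_le measurable_const m₂
  have mB₃ : MeasurableSet B₃ := measurableSet_le measurable_const m₃
  have p₁ : initLaw m p B₁ ≤ ENNReal.ofReal (δ / 3) :=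
    measure_le_of_lintegral_le m₁ (lintegral_frobenius_le hx hm) (by positivity) (by
      rw [← mul_assoc, mul_one_div, div_le_iff₀ hm']
      nlinarith)
  have p₂ : initLaw m p B₂ ≤ ENNReal.ofReal (δ / 3) :=
    measure_le_of_lintegral_le m₂ (lintegral_sum_err_sq_le hx hy) (by positivity) (le_of_eq (by
      field_simp))
  have p₃ : initLaw m p B₃ ≤ ENNReal.ofReal (δ / 3) :=
    measure_le_of_lintegral_le m₃ (lintegral_sum_small_le hx R) (by positivity) (le_of_eq (by
      field_simp))
  have pA : initLaw m p Aᶜ = 0 := ae_abs_eq_one_initLaw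
  refine ⟨(Aᶜ ∪ B₁ ∪ B₂ ∪ B₃)ᶜ, (((mA.compl.union mB₁).union mB₂).union mB₃).compl, ?_, ?_⟩
  · rw [prob_compl_eq_one_sub (((mA.compl.union mB₁).union mB₂).union mB₃),
      ENNReal.ofReal_sub _ hδ.le, ENNReal.ofReal_one]
    refine tsub_le_tsub_left ?_ 1
    calc initLaw m p (Aᶜ ∪ B₁ ∪ B₂ ∪ B₃)
        ≤ initLaw m p Aᶜ + initLaw m p B₁ + initLaw m p B₂ + initLaw m p B₃ :=
          (measure_union_le _ _).trans (add_le_add_left ((measure_union_le _ _).trans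
            (add_le_add_left (measure_union_le _ _) _)) _)
      _ ≤ 0 + ENNReal.ofReal (δ / 3) + ENNReal.ofReal (δ / 3) + ENNReal.ofReal (δ / 3) := by
          rw [pA]
          gcongr
      _ = ENNReal.ofReal δ := by
          rw [zero_add, ← ENNReal.ofReal_add (by positivity) (by positivity),
            ← ENNReal.ofReal_add (by positivity) (by positivity)]
          congr 1
          ring
  · intro ω hω
    simp only [compl_union, compl_compl, mem_inter_iff] at hω
    obtain ⟨⟨⟨h0, h1⟩, h2⟩, h3⟩ := hω
    have h1' : f₁ ω < ε ^ 2 := not_le.1 h1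
    have h3' : f₃ ω < 3 / δ * (n * (m * R)) := not_le.1 h3
    refine ⟨h0, ?_, not_le.1 h2, h3'.le⟩
    simp only [ntk_eq_empKernel x h0]
    exact h1'.le

/-- Linear convergence of the heavy ball flow with high probability over the initialization. -/
theorem exists_linear_convergence {C δ : ℝ} {x : Fin n → EuclideanSpace ℝ (Fin p)} {y : Fin n → ℝ}
    (hx : ∀ i, ‖x i‖ = 1) (hy : ∀ i, |y i| < C) (hδ : 0 < δ) (hδ1 : δ < 1) (hlam : 0 < lam0 x)
    (hm : 344064 * (C ^ 2 + 1) * ((n : ℝ) ^ 6 / (δ ^ 3 * lam0 x ^ 4)) ≤ m) :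
    ∃ S : Set (Weights m p × (Fin m → ℝ)), MeasurableSet S ∧
      ENNReal.ofReal (1 - δ) ≤ initLaw m p S ∧
      ∀ ω ∈ S, ∀ W : ℝ → Weights m p, IsHBFlow x y ω.2 √(2 * lam0 x) ω.1 W →
        ∀ t : ℝ, 0 ≤ t → loss x y ω.2 (W t)
          ≤ 4 / lam0 x * Real.exp (-√(lam0 x / 2) * t) * pseudoLoss x y ω.2 ω.1 := by
  have hn := pos_of_lam0_pos hlam
  have hlam1 := lam0_le_one hx hn
  set lam := lam0 x
  have hn1 : (1 : ℝ) ≤ n := by exact_mod_cast hn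
  have hn' : (0 : ℝ) < n := by linarith
  have hm' : (0 : ℝ) < m := lt_of_lt_of_le (by positivity) hm
  have hmN : 0 < m := by exact_mod_cast hm'
  have hm2 : 344064 * (C ^ 2 + 1) * (n : ℝ) ^ 6 ≤ m * (δ ^ 3 * lam ^ 4) := by
    rwa [← mul_div_assoc, div_le_iff₀ (by positivity)] at hm
  -- This is 7/2 times the Markov bound for |Δ(0)|², so the bootstrap may start; R is then the
  -- resulting displacement bound, with equality in `hR`.
  set B2 : ℝ := 7 / 2 * (3 / δ * (n * (2 + 2 * C ^ 2))) with hB2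
  have hB2pos : 0 < B2 := by positivity
  set R : ℝ := 8 / (3 * lam) * (√(n : ℝ) * √B2) / √(m : ℝ) with hRdef
  have hsm : 0 < √(m : ℝ) := Real.sqrt_pos.2 hm'
  have hsn : 0 < √(n : ℝ) := Real.sqrt_pos.2 hn'
  have hsB : 0 < √B2 := Real.sqrt_pos.2 hB2pos
  have hR : 0 < R := by positivity
  have hR2 : R ^ 2 * m = 64 / (9 * lam ^ 2) * (n * B2) := by
    rw [hRdef, div_pow, mul_pow, mul_pow, div_pow, Real.sq_sqrt hn'.le, Real.sq_sqrt hB2pos.le,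
      Real.sq_sqrt hm'.le]
    field_simp
    ring
  have hε : 3 * (n : ℝ) ^ 2 ≤ (lam / 8) ^ 2 * δ * m := by
    have h1 : (n : ℝ) ^ 2 ≤ (n : ℝ) ^ 6 := pow_le_pow_right₀ hn1 (by norm_num)
    have h2 : 192 * (n : ℝ) ^ 6 ≤ 344064 * (C ^ 2 + 1) * (n : ℝ) ^ 6 := by
      refine mul_le_mul_of_nonneg_right ?_ (by positivity)
      nlinarith [sq_nonneg C]
    have h3 : δ ^ 2 * lam ^ 2 ≤ 1 := mul_le_one₀ (pow_le_one₀ hδ.le hδ1.le) (by positivity)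
      (pow_le_one₀ hlam.le hlam1)
    have h4 : (m : ℝ) * (δ ^ 3 * lam ^ 4) ≤ m * (δ * lam ^ 2) := by
      have : δ ^ 3 * lam ^ 4 = δ * lam ^ 2 * (δ ^ 2 * lam ^ 2) := by ring
      rw [this]
      exact mul_le_mul_of_nonneg_left (mul_le_of_le_one_right (by positivity) h3) hm'.le
    nlinarith
  -- The binding constraint on the width: 1344 (C² + 1) n⁵/(δ³λ²) ≤ mλ²/256, and 1344·256 = 344064.
  -- The fifth power of n suffices here.
  have hσ : n * (3 / δ * (n * R)) ^ 2 ≤ lam ^ 2 / 256 := by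
    have e : n * (3 / δ * (n * R)) ^ 2 * m = 1344 * (C ^ 2 + 1) * (n : ℝ) ^ 5
        / (δ ^ 3 * lam ^ 2) := by
      calc n * (3 / δ * (n * R)) ^ 2 * m = 9 * n ^ 3 / δ ^ 2 * (R ^ 2 * m) := by
            field_simp
            ring
        _ = _ := by
            rw [hR2, hB2]
            field_simp
            ring
    have h1 : (n : ℝ) ^ 5 ≤ (n : ℝ) ^ 6 := pow_le_pow_right₀ hn1 (by norm_num)
    have h2 : 344064 * (C ^ 2 + 1) * (n : ℝ) ^ 5 ≤ 344064 * (C ^ 2 + 1) * (n : ℝ) ^ 6 :=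
      mul_le_mul_of_nonneg_left h1 (by positivity)
    refine le_of_mul_le_mul_right ?_ hm'
    rw [e, div_le_iff₀ (by positivity)]
    nlinarith
  obtain ⟨S, hS, hprob, hgood⟩ := exists_good_initialization (m := m) (R := R) (ε := lam / 8)
    hx hy hn hmN hδ (by positivity) hR hε
  refine ⟨S, hS, hprob, fun ω hω W hW t ht => ?_⟩
  obtain ⟨ha, hK, hE, hI⟩ := hgood ω hω
  have hpos : ∀ w, 7 / 8 * lam * (w ⬝ᵥ w) ≤ w ⬝ᵥ ntk x ω.2 ω.1 *ᵥ w := fun w => by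
    have := coercive_of_frobenius (by positivity) (lam0_mul_le x) hK w
    linarith
  refine hW.loss_le hmN hx ha hlam hpos (R := R) (σ := 3 / δ * (n * R)) (B := √B2) hsB.le ?_ ?_ hσ
    ?_ ht
  · rw [hRdef, div_mul_cancel₀ _ hsm.ne']
  · refine hI.trans (le_of_eq ?_)
    ring
  · rw [Real.sq_sqrt hB2pos.le, hB2]
    linarith

end NAGSC

end

open NAGSC in
theorem mainTheorem3 :
    -- the limiting ODE of NAG-SC (time step `√η`) is the Heavy Ball ODE with `b = √(2λ₀)`
    (∀ (n p m : ℕ) (x : Fin n → EuclideanSpace ℝ (Fin p)) (y : Fin n → ℝ) (a : Fin m → ℝ)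
      (X X' : ℝ → Weights m p) (X'' : Weights m p) (t : ℝ),
      (∀ᶠ s in 𝓝 t, HasDerivAt X (X' s) s) → HasDerivAt X' X'' t →
      (∀ r i, inner ℝ (X t r) (x i) ≠ 0) →
      Tendsto (fun η : ℝ => η⁻¹ • (X (t + √η) - nagStep x y a η (X (t - √η)) (X t)))
        (𝓝[>] 0) (𝓝 (X'' + √(2 * lam0 x) • X' t + lossGrad x y a (X t)))) ∧
    -- linear convergence with high probability over the initialization
    (∀ C : ℝ, ∃ K : ℝ, 0 < K ∧
      ∀ (n p m : ℕ) (x : Fin n → EuclideanSpace ℝ (Fin p)) (y : Fin n → ℝ) (δ : ℝ),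
        (∀ i, ‖x i‖ = 1) → (∀ i, |y i| < C) → 0 < δ → δ < 1 → 0 < lam0 x →
        K * ((n : ℝ) ^ 6 / (δ ^ 3 * lam0 x ^ 4)) ≤ m →
        ∃ S : Set (Weights m p × (Fin m → ℝ)), MeasurableSet S ∧
          ENNReal.ofReal (1 - δ) ≤ initLaw m p S ∧
          ∀ ω ∈ S, ∀ W : ℝ → Weights m p,
            IsHBFlow x y ω.2 (√(2 * lam0 x)) ω.1 W →
            ∀ t : ℝ, 0 ≤ t →
              loss x y ω.2 (W t) ≤
                4 / lam0 x * Real.exp (-√(lam0 x / 2) * t) * pseudoLoss x y ω.2 ω.1) :=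
  ⟨fun _ _ _ x y a X X' X'' t hX hX' hne => tendsto_nagStep x y a X X' X'' t hX hX' hne,
    fun C => ⟨344064 * (C ^ 2 + 1), by positivity,
      fun _ _ _ _ _ _ hx hy hδ hδ1 hlam hm => exists_linear_convergence hx hy hδ hδ1 hlam hm⟩⟩
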